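/- Let $P\subset\mathbb{R}^2$ be a lattice polygon, i.e. a convex hull of finitely many points of $\mathbb{Z}^2$ that has nonempty interior. Let $\mathcal{T}$ be a unimodular triangulation of $P$, that is, a triangulation of $P$ with vertices in $\mathbb{Z}^2$ all of whose triangles have area $1/2$. Put $V=P\cap\mathbb{Z}^2$, $V^o=\operatorname{int}(P)\cap\mathbb{Z}^2$ and $\partial V=\partial P\cap\mathbb{Z}^2$, and let $E^o$ be the set of edges $\{y,z\}$ of $\mathcal{T}$ whose open segment $(y,z)$ is not contained in the boundary $\partial P$. For a bounded set $S\subset\mathbb{R}^2$ let $L^1(S)=\sum_{x\in S\cap\mathbb{Z}^2}x\in\mathbb{R}^2$ be its discrete moment vector. Then for every integer $n\ge 0$ $$ L^1(nP)=\frac{n}{6}\Big(2\sum_{x\in V}x+4\sum_{x\in V^o}x-\sum_{\{y,z\}\in E^o}(y+z)\Big)+\frac{n^2}{2}\sum_{x\in\partial V}x+\frac{n^3}{6}\Big(\sum_{x\in\partial V}x+\sum_{\{y,z\}\in E^o}(y+z)\Big). $$ -/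

import Mathlib

open scoped Pointwise

namespace LatticePolygon

/-- The integer lattice `ℤ²` inside the plane `ℝ²`. Only the linear structure, the topology and
the Lebesgue measure of the plane are used, so the plane is modelled as `Fin 2 → ℝ`. -/
def lattice : Set (Fin 2 → ℝ) :=
  Set.range fun (m : Fin 2 → ℤ) (i : Fin 2) => (m i : ℝ)

/-- A lattice polygon: the convex hull of finitely many lattice points that is 2-dimensional,
i.e. has nonempty interior in the plane. -/
def IsLatticePolygon (P : Set (Fin 2 → ℝ)) : Prop :=
  (∃ s : Finset (Fin 2 → ℝ), (s : Set (Fin 2 → ℝ)) ⊆ lattice ∧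
    P = convexHull ℝ (s : Set (Fin 2 → ℝ))) ∧ (interior P).Nonempty

/-- The lattice points of a subset of the plane. -/
def latticePoints (S : Set (Fin 2 → ℝ)) : Set (Fin 2 → ℝ) := S ∩ lattice

/-- Bounded sets have finitely many lattice points, so the sums below are genuine finite sums. -/
theorem latticePoints_finite {S : Set (Fin 2 → ℝ)} (hS : Bornology.IsBounded S) :
    (latticePoints S).Finite := by
  obtain ⟨R, hR⟩ := hS.exists_norm_le
  have hfin : (Set.Icc (fun _ : Fin 2 => -⌈R⌉) (fun _ : Fin 2 => ⌈R⌉)).Finite :=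
    Set.finite_Icc _ _
  refine (hfin.image fun (m : Fin 2 → ℤ) (i : Fin 2) => (m i : ℝ)).subset ?_
  rintro x ⟨hxS, m, rfl⟩
  refine ⟨m, ⟨fun i => ?_, fun i => ?_⟩, rfl⟩ <;>
  · have h1 := (norm_le_pi_norm (fun i => (m i : ℝ)) i).trans (hR _ hxS)
    rw [Real.norm_eq_abs, abs_le] at h1
    have h2 := Int.le_ceil R
    have h3 : -(⌈R⌉ : ℝ) ≤ m i ∧ (m i : ℝ) ≤ ⌈R⌉ := ⟨by linarith [h1.1], by linarith [h1.2]⟩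
    first
      | exact_mod_cast h3.1
      | exact_mod_cast h3.2

/-- The discrete moment vector `L¹(S)`, the sum of all lattice points of `S`. -/
noncomputable def discreteMomentVector (S : Set (Fin 2 → ℝ)) : Fin 2 → ℝ :=
  ∑ᶠ x ∈ latticePoints S, x

/-- `T` is a unimodular triangulation of `P`: a geometric simplicial complex with underlying
space `P` and lattice vertices, all of whose maximal simplices have the minimal area `1/2`. -/
structure IsUnimodularTriangulation
    (T : Geometry.SimplicialComplex ℝ (Fin 2 → ℝ)) (P : Set (Fin 2 → ℝ)) : Prop where
  space_eq : T.space = P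
  vertices_subset : T.vertices ⊆ lattice
  area_eq : ∀ s ∈ T.facets,
    MeasureTheory.volume (convexHull ℝ (s : Set (Fin 2 → ℝ))) = 1 / 2

/-- The interior edges `E°` of a triangulation `T` of `P`: the edges `{y, z}` of `T` such that
the open segment `(y, z)` is not contained in the boundary of `P`. -/
def interiorEdges (T : Geometry.SimplicialComplex ℝ (Fin 2 → ℝ)) (P : Set (Fin 2 → ℝ)) :
    Set (Finset (Fin 2 → ℝ)) :=
  {e | e ∈ T.faces ∧ ∃ y z : Fin 2 → ℝ, y ≠ z ∧ (e : Set (Fin 2 → ℝ)) = {y, z} ∧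
    ¬ openSegment ℝ y z ⊆ frontier P}

/-- A lattice polygon is bounded. -/
theorem IsLatticePolygon.isBounded {P : Set (Fin 2 → ℝ)} (hP : IsLatticePolygon P) :
    Bornology.IsBounded P := by
  obtain ⟨⟨s, -, rfl⟩, -⟩ := hP
  exact isBounded_convexHull.2 s.finite_toSet.isBounded

/-- A unimodular triangulation of a lattice polygon has finitely many interior edges. -/
theorem interiorEdges_finite {T : Geometry.SimplicialComplex ℝ (Fin 2 → ℝ)}
    {P : Set (Fin 2 → ℝ)} (hP : IsLatticePolygon P) (hT : IsUnimodularTriangulation T P) :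
    (interiorEdges T P).Finite := by
  have hfin := latticePoints_finite hP.isBounded
  refine (hfin.toFinset.powerset.finite_toSet).subset ?_
  rintro e ⟨he, -⟩
  simp only [Finset.mem_coe, Finset.mem_powerset]
  intro x hx
  rw [Set.Finite.mem_toFinset]
  have hv : x ∈ T.vertices :=
    T.down_closed he (Finset.singleton_subset_iff.2 hx) (Finset.singleton_nonempty _)
  exact ⟨hT.space_eq ▸ T.vertices_subset_space hv, hT.vertices_subset hv⟩

end LatticePolygon

/-! For `n ≥ 1`, `nP` is the disjoint union of the dilated relative interiors of the faces of `T`.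
Unimodularity makes barycentric coordinates of lattice points integral, so the lattice points of
`nP` belonging to a face `s` are exactly the sums `∑ k v • v` over `v ∈ s` with positive integers `k
v` of total `n`. There are `(n - 1).choose (s.card - 1)` such weights, and by symmetry each vertex
carries the same total weight. Hence `s` contributes `n * (n - 1).choose (s.card - 1) / s.card`
times its vertex sum (`discreteMomentVector_eq_sum_faces`).

This expresses the moment vector through the vertex sums over all vertices, all edges and all
triangles. Two double counts reduce these to the sums of the theorem. An interior edge lies in two
triangles and a boundary edge in one (`card_triangles_containing`), while each vertex of a triangle
lies on two of its edges. So twice the triangle sum is twice the interior edge sum plus the boundary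
edge sum. Every boundary vertex lies on exactly two boundary edges (`card_boundary_edges_at`), so
the boundary edge sum is twice the sum over boundary lattice points. The rest is algebra in `n`.

The incidence counts are the geometric part. Sides of a line are signs of the determinant `cross`,
and local structure comes from following a short segment into the polygon until it lies in one
triangle (`exists_facet_toward`). -/

namespace LatticePolygon

/-! ### Positive integer weights of given total -/

/-- The finitely supported functions with natural values, support `s` and total `n`. -/
noncomputable def compositions (s : Finset (Fin 2 → ℝ)) (n : ℕ) : Finset ((Fin 2 → ℝ) →₀ ℕ) :=
  (s.finsuppAntidiag n).filter fun k => k.support = s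

/-- The linear combination of points with the given natural weights. -/
noncomputable def weightedSum (k : (Fin 2 → ℝ) →₀ ℕ) : Fin 2 → ℝ :=
  ∑ v ∈ k.support, (k v : ℝ) • v

theorem mem_compositions {s : Finset (Fin 2 → ℝ)} {n : ℕ} {k : (Fin 2 → ℝ) →₀ ℕ} :
    k ∈ compositions s n ↔ k.support = s ∧ ∑ v ∈ s, k v = n := by
  simp only [compositions, Finset.mem_filter, Finset.mem_finsuppAntidiag]
  constructor
  · rintro ⟨⟨h1, -⟩, h2⟩
    exact ⟨h2, h1⟩
  · rintro ⟨h1, h2⟩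
    exact ⟨⟨h2, h1.le⟩, h1⟩

/-- Stars and bars, after lowering every weight by one. When `n < s.card` both sides vanish; `1 ≤ n`
keeps the truncated `n - 1` honest. -/
theorem card_compositions (s : Finset (Fin 2 → ℝ)) (hs : s.Nonempty) {n : ℕ} (hn : 1 ≤ n) :
    (compositions s n).card = (n - 1).choose (s.card - 1) := by
  have hc : 1 ≤ s.card := hs.card_pos
  rcases lt_or_ge n s.card with h | h
  · rw [Nat.choose_eq_zero_of_lt (by omega), Finset.card_eq_zero, Finset.eq_empty_iff_forall_notMem]
    intro k hk
    obtain ⟨h1, h2⟩ := mem_compositions.1 hk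
    have : s.card • 1 ≤ ∑ v ∈ s, k v := Finset.card_nsmul_le_sum _ _ _ fun v hv => by
      rw [← h1] at hv
      exact Nat.one_le_iff_ne_zero.2 (Finsupp.mem_support_iff.1 hv)
    simp at this
    omega
  · have key : (compositions s n).card = (s.finsuppAntidiag (n - s.card)).card := by
      symm
      refine Finset.card_bij' (fun k _ => k + Finsupp.indicator s fun _ _ => 1)
        (fun k _ => k - Finsupp.indicator s fun _ _ => 1) ?_ ?_ ?_ ?_
      · intro k hk
        obtain ⟨h1, h2⟩ := Finset.mem_finsuppAntidiag.1 hk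
        refine mem_compositions.2 ⟨?_, ?_⟩
        · ext v
          by_cases hv : v ∈ s
          · simp [Finsupp.indicator_apply, hv]
          · have : k v = 0 := Finsupp.notMem_support_iff.1 fun h' => hv (h2 h')
            simp [Finsupp.indicator_apply, hv, this]
        · rw [Finset.sum_congr rfl (g := fun v => k v + 1) fun v hv => by
            simp [Finsupp.indicator_apply, hv], Finset.sum_add_distrib]
          change ∑ v ∈ s, k v = _ at h1
          simp only [Finset.sum_const, smul_eq_mul, mul_one]
          omega
      · intro k hk
        obtain ⟨h1, h2⟩ := mem_compositions.1 hk
        refine Finset.mem_finsuppAntidiag.2 ⟨?_, ?_⟩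
        · have h3 : ∑ v ∈ s, (k v - 1) + ∑ v ∈ s, 1 = ∑ v ∈ s, k v := by
            rw [← Finset.sum_add_distrib]
            refine Finset.sum_congr rfl fun v hv => ?_
            rw [← h1] at hv
            have := Finsupp.mem_support_iff.1 hv
            omega
          have h4 : ∑ v ∈ s, (k - Finsupp.indicator s fun _ _ => 1 : (Fin 2 → ℝ) →₀ ℕ) v =
              ∑ v ∈ s, (k v - 1) :=
            Finset.sum_congr rfl fun v hv => by simp [Finsupp.indicator_apply, hv]
          simp only [Finset.sum_const, smul_eq_mul, mul_one] at h3
          change ∑ v ∈ s, (k - Finsupp.indicator s fun _ _ => 1 : (Fin 2 → ℝ) →₀ ℕ) v = _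
          omega
        · intro v hv
          by_contra hvs
          rw [← h1, Finsupp.mem_support_iff, not_not] at hvs
          simp [hvs] at hv
      · intro k _
        simp
      · intro k hk
        obtain ⟨h1, h2⟩ := mem_compositions.1 hk
        ext v
        by_cases hv : v ∈ s
        · have := hv
          rw [← h1] at this
          have := Finsupp.mem_support_iff.1 this
          simp [Finsupp.indicator_apply, hv]
          omega
        · simp [Finsupp.indicator_apply, hv]
    rw [key, Finset.card_finsuppAntidiag_nat_eq_choose,
      show s.card + (n - s.card) - 1 = n - 1 by omega,
      ← Nat.choose_symm (show n - s.card ≤ n - 1 by omega)]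
    congr 1
    omega

/-- Swapping `u` and `v` permutes the compositions. -/
theorem sum_compositions_apply_eq (s : Finset (Fin 2 → ℝ)) (n : ℕ) {u v : Fin 2 → ℝ}
    (hu : u ∈ s) (hv : v ∈ s) :
    ∑ k ∈ compositions s n, k u = ∑ k ∈ compositions s n, k v := by
  have hsw : ∀ k ∈ compositions s n,
      Finsupp.equivMapDomain (Equiv.swap u v) k ∈ compositions s n := by
    intro k hk
    obtain ⟨h1, h2⟩ := mem_compositions.1 hk
    have hmem : ∀ w, Equiv.swap u v w ∈ s ↔ w ∈ s := by
      intro w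
      rcases eq_or_ne w u with rfl | hwu
      · simp [hu, hv]
      · rcases eq_or_ne w v with rfl | hwv
        · simp [hu, hv]
        · rw [Equiv.swap_apply_of_ne_of_ne hwu hwv]
    refine mem_compositions.2 ⟨?_, ?_⟩
    · ext w
      rw [Finsupp.mem_support_iff, Finsupp.equivMapDomain_apply, Equiv.symm_swap,
        ← Finsupp.mem_support_iff, h1, hmem]
    · rw [← h2]
      refine Finset.sum_equiv (Equiv.swap u v) (fun w => (hmem w).symm) fun w _ => ?_
      rw [Finsupp.equivMapDomain_apply, Equiv.symm_swap]
  refine Finset.sum_bij' (fun k _ => Finsupp.equivMapDomain (Equiv.swap u v) k)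
    (fun k _ => Finsupp.equivMapDomain (Equiv.swap u v) k) hsw hsw ?_ ?_ ?_
  · intro k _
    ext w
    simp [Finsupp.equivMapDomain_apply]
  · intro k _
    ext w
    simp [Finsupp.equivMapDomain_apply]
  · intro k _
    simp [Finsupp.equivMapDomain_apply]

/-- By symmetry, summing over the points of `s` multiplies by `s.card`; exchanging the sums, each
composition contributes its total `n`. -/
theorem card_mul_sum_compositions_apply (s : Finset (Fin 2 → ℝ)) {n : ℕ} (hn : 1 ≤ n)
    {v : Fin 2 → ℝ} (hv : v ∈ s) :
    s.card * ∑ k ∈ compositions s n, k v = n * (n - 1).choose (s.card - 1) := by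
  have h1 : ∑ u ∈ s, ∑ k ∈ compositions s n, k u = s.card * ∑ k ∈ compositions s n, k v := by
    rw [Finset.sum_congr rfl fun u hu => sum_compositions_apply_eq s n hu hv]
    simp
  rw [← h1, Finset.sum_comm, Finset.sum_congr rfl fun k hk => (mem_compositions.1 hk).2,
    Finset.sum_const, card_compositions s ⟨v, hv⟩ hn, smul_eq_mul, mul_comm]

theorem sum_weightedSum_compositions (s : Finset (Fin 2 → ℝ)) (hs : s.Nonempty) {n : ℕ}
    (hn : 1 ≤ n) :
    ∑ k ∈ compositions s n, weightedSum k =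
      ((n * (n - 1).choose (s.card - 1) : ℝ) / s.card) • ∑ v ∈ s, v := by
  have hc : (s.card : ℝ) ≠ 0 := by exact_mod_cast hs.card_pos.ne'
  have h1 : ∀ k ∈ compositions s n, weightedSum k = ∑ v ∈ s, (k v : ℝ) • v := fun k hk => by
    rw [weightedSum, (mem_compositions.1 hk).1]
  rw [Finset.sum_congr rfl h1, Finset.sum_comm, Finset.smul_sum]
  refine Finset.sum_congr rfl fun v hv => ?_
  rw [← Finset.sum_smul]
  congr 1
  rw [eq_div_iff hc, mul_comm]
  exact_mod_cast card_mul_sum_compositions_apply s hn hv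

/-! ### Relative interiors of faces -/

/-- The point also lies in the hull of `s ∩ t`. Affine independence of `s` makes its weights unique,
so a vertex outside `t` would have weight zero. -/
theorem subset_of_pos_combination_mem {T : Geometry.SimplicialComplex ℝ (Fin 2 → ℝ)}
    {s t : Finset (Fin 2 → ℝ)} (hs : s ∈ T.faces) (ht : t ∈ T.faces)
    {w : (Fin 2 → ℝ) → ℝ} (hw : ∀ v ∈ s, 0 < w v) (hw1 : ∑ v ∈ s, w v = 1)
    (hmem : ∑ v ∈ s, w v • v ∈ convexHull ℝ (t : Set (Fin 2 → ℝ))) : s ⊆ t := by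
  have h1 : ∑ v ∈ s, w v • v ∈ convexHull ℝ (s : Set (Fin 2 → ℝ)) :=
    Finset.mem_convexHull'.2 ⟨w, fun v hv => (hw v hv).le, hw1, rfl⟩
  have h2 := T.inter_subset_convexHull hs ht ⟨h1, hmem⟩
  rw [← Finset.coe_inter, Finset.mem_convexHull'] at h2
  obtain ⟨u, hu0, hu1, hu2⟩ := h2
  have hsum : ∀ {M : Type} [AddCommMonoid M] (f : (Fin 2 → ℝ) → M),
      ∑ v ∈ s, (if v ∈ t then f v else 0) = ∑ v ∈ s ∩ t, f v := fun f => by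
    rw [← Finset.filter_mem_eq_inter, Finset.sum_filter]
  have h3 := (T.indep hs).eq_of_sum_eq_sum_subtype (w₁ := w)
    (w₂ := fun v => if v ∈ t then u v else 0)
    (by rw [hw1, hsum, hu1])
    (by simp only [ite_smul, zero_smul]; rw [hsum, hu2])
  intro v hv
  by_contra hvt
  have h4 := h3 v hv
  have h5 := hw v hv
  simp only [hvt, if_false] at h4
  linarith

/-- A point lies in the relative interior of at most one face, with unique weights. -/
theorem eq_of_pos_combination_eq {T : Geometry.SimplicialComplex ℝ (Fin 2 → ℝ)}
    {s t : Finset (Fin 2 → ℝ)} (hs : s ∈ T.faces) (ht : t ∈ T.faces)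
    {w w' : (Fin 2 → ℝ) → ℝ} (hw : ∀ v ∈ s, 0 < w v) (hw1 : ∑ v ∈ s, w v = 1)
    (hw' : ∀ v ∈ t, 0 < w' v) (hw1' : ∑ v ∈ t, w' v = 1)
    (heq : ∑ v ∈ s, w v • v = ∑ v ∈ t, w' v • v) : s = t ∧ ∀ v ∈ s, w v = w' v := by
  have hst : s = t := by
    refine Finset.Subset.antisymm (subset_of_pos_combination_mem hs ht hw hw1 ?_)
      (subset_of_pos_combination_mem ht hs hw' hw1' ?_)
    · rw [heq]
      exact Finset.mem_convexHull'.2 ⟨w', fun v hv => (hw' v hv).le, hw1', rfl⟩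
    · rw [← heq]
      exact Finset.mem_convexHull'.2 ⟨w, fun v hv => (hw v hv).le, hw1, rfl⟩
  subst hst
  exact ⟨rfl, (T.indep hs).eq_of_sum_eq_sum_subtype (by rw [hw1, hw1']) heq⟩

/-! ### Determinants and areas -/

/-- The determinant of two plane vectors. -/
def cross (u v : Fin 2 → ℝ) : ℝ := u 0 * v 1 - u 1 * v 0

theorem volume_standard_triangle :
    MeasureTheory.volume {x : Fin 2 → ℝ | 0 ≤ x 0 ∧ 0 ≤ x 1 ∧ x 0 + x 1 ≤ 1} = 1 / 2 := by
  set S : Set (ℝ × ℝ) := {p | 0 ≤ p.1 ∧ 0 ≤ p.2 ∧ p.1 + p.2 ≤ 1} with hS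
  have hmeas : MeasurableSet S := by
    refine IsClosed.measurableSet ?_
    have h1 : IsClosed {p : ℝ × ℝ | 0 ≤ p.1} := isClosed_le continuous_const continuous_fst
    have h2 : IsClosed {p : ℝ × ℝ | 0 ≤ p.2} := isClosed_le continuous_const continuous_snd
    have h3 : IsClosed {p : ℝ × ℝ | p.1 + p.2 ≤ 1} :=
      isClosed_le (continuous_fst.add continuous_snd) continuous_const
    exact h1.inter (h2.inter h3)
  have hpre : {x : Fin 2 → ℝ | 0 ≤ x 0 ∧ 0 ≤ x 1 ∧ x 0 + x 1 ≤ 1} =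
      MeasurableEquiv.finTwoArrow ⁻¹' S := by
    ext x
    simp [hS, MeasurableEquiv.finTwoArrow]
  rw [hpre, (MeasureTheory.volume_preserving_finTwoArrow ℝ).measure_preimage
    hmeas.nullMeasurableSet, MeasureTheory.Measure.volume_eq_prod,
    MeasureTheory.Measure.prod_apply hmeas]
  have hslice : ∀ x : ℝ, MeasureTheory.volume (Prod.mk x ⁻¹' S) =
      (Set.Icc (0 : ℝ) 1).indicator (fun x => ENNReal.ofReal (1 - x)) x := by
    intro x
    by_cases hx : x ∈ Set.Icc (0 : ℝ) 1
    · have : Prod.mk x ⁻¹' S = Set.Icc 0 (1 - x) := by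
        ext y
        simp only [hS, Set.mem_preimage, Set.mem_ofPred_eq, Set.mem_Icc]
        exact ⟨fun h => ⟨h.2.1, by linarith [h.2.2]⟩, fun h => ⟨hx.1, h.1, by linarith [h.2]⟩⟩
      rw [this, Set.indicator_of_mem hx, Real.volume_Icc, sub_zero]
    · have : Prod.mk x ⁻¹' S = ∅ := by
        ext y
        simp only [hS, Set.mem_preimage, Set.mem_ofPred_eq, Set.mem_empty_iff_false, iff_false]
        exact fun h => hx ⟨h.1, by linarith [h.2.1, h.2.2]⟩
      rw [this, Set.indicator_of_notMem hx, MeasureTheory.measure_empty]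
  simp_rw [hslice]
  rw [MeasureTheory.lintegral_indicator measurableSet_Icc,
    ← MeasureTheory.ofReal_integral_eq_lintegral_ofReal]
  · rw [MeasureTheory.integral_Icc_eq_integral_Ioc,
      ← intervalIntegral.integral_of_le zero_le_one]
    have : ∫ x in (0 : ℝ)..1, (1 - x) = 1 / 2 := by
      rw [intervalIntegral.integral_sub (by simp) (by simp)]
      simp
      norm_num
    rw [this, ENNReal.ofReal_div_of_pos two_pos]
    simp
  · exact (continuous_const.sub continuous_id).integrableOn_Icc
  · filter_upwards [MeasureTheory.ae_restrict_mem measurableSet_Icc] with x hx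
    simpa using hx.2

theorem mem_convexHull_triple {a b c x : Fin 2 → ℝ} :
    x ∈ convexHull ℝ ({a, b, c} : Set (Fin 2 → ℝ)) ↔
      ∃ p q : ℝ, 0 ≤ p ∧ 0 ≤ q ∧ p + q ≤ 1 ∧ x = a + p • (b - a) + q • (c - a) := by
  rw [convexHull_insert (Set.insert_nonempty _ _), convexHull_pair, mem_convexJoin]
  constructor
  · rintro ⟨a', ha', y, ⟨p, q, hp, hq, hpq, rfl⟩, r, s, hr, hs, hrs, rfl⟩
    rw [Set.mem_singleton_iff] at ha'
    subst ha'
    refine ⟨s * p, s * q, by positivity, by positivity, ?_, ?_⟩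
    · rw [← mul_add, hpq]
      linarith
    · obtain rfl : r = 1 - s := by linarith
      obtain rfl : p = 1 - q := by linarith
      module
  · rintro ⟨p, q, hp, hq, hpq, rfl⟩
    rcases (add_nonneg hp hq).eq_or_lt with h | h
    · obtain rfl : p = 0 := by linarith
      obtain rfl : q = 0 := by linarith
      exact ⟨a, rfl, b, left_mem_segment _ _ _, by simpa using left_mem_segment ℝ a b⟩
    · refine ⟨a, rfl, (p / (p + q)) • b + (q / (p + q)) • c,
        ⟨_, _, by positivity, by positivity, by field_simp, rfl⟩,
        1 - (p + q), p + q, by linarith, h.le, by ring, ?_⟩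
      rw [smul_add, smul_smul, smul_smul, mul_div_cancel₀ _ h.ne', mul_div_cancel₀ _ h.ne']
      module

/-- The triangle is an affine image of the standard one, with linear part having columns `b - a` and
`c - a`. -/
theorem volume_triangle (a b c : Fin 2 → ℝ) :
    MeasureTheory.volume (convexHull ℝ ({a, b, c} : Set (Fin 2 → ℝ))) =
      ENNReal.ofReal |cross (b - a) (c - a)| * (1 / 2) := by
  set M : Matrix (Fin 2) (Fin 2) ℝ :=
    !![(b - a) 0, (c - a) 0; (b - a) 1, (c - a) 1] with hM
  have himg : convexHull ℝ ({a, b, c} : Set (Fin 2 → ℝ)) = (fun x => a + x) ''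
      (Matrix.toLin' M '' {x : Fin 2 → ℝ | 0 ≤ x 0 ∧ 0 ≤ x 1 ∧ x 0 + x 1 ≤ 1}) := by
    have hMx : ∀ x : Fin 2 → ℝ, Matrix.toLin' M x = x 0 • (b - a) + x 1 • (c - a) := by
      intro x
      ext i
      fin_cases i <;> simp [hM, Matrix.mulVec, dotProduct, Fin.sum_univ_two] <;> ring
    ext x
    rw [mem_convexHull_triple]
    constructor
    · rintro ⟨p, q, hp, hq, hpq, rfl⟩
      refine ⟨_, ⟨![p, q], by simpa using ⟨hp, hq, hpq⟩, rfl⟩, ?_⟩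
      simp [hMx, add_assoc]
    · rintro ⟨_, ⟨x, ⟨h1, h2, h3⟩, rfl⟩, rfl⟩
      exact ⟨x 0, x 1, h1, h2, h3, by simp only [hMx, add_assoc]⟩
  have hdet : LinearMap.det (Matrix.toLin' M) = cross (b - a) (c - a) := by
    rw [LinearMap.det_toLin', Matrix.det_fin_two, hM]
    simp [cross]
    ring
  rw [himg, Set.image_add_left, MeasureTheory.measure_preimage_add,
    MeasureTheory.Measure.addHaar_image_linearMap, hdet, volume_standard_triangle]

/-- An affinely independent set with any other number of points does not span the plane affinely, so
its hull is null, contrary to area `1/2`. -/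
theorem card_facet_eq_three {T : Geometry.SimplicialComplex ℝ (Fin 2 → ℝ)}
    {P : Set (Fin 2 → ℝ)} (hT : IsUnimodularTriangulation T P) {t : Finset (Fin 2 → ℝ)}
    (ht : t ∈ T.facets) : t.card = 3 := by
  have hind := T.indep ht.1
  rw [← Fintype.card_coe, show 3 = Module.finrank ℝ (Fin 2 → ℝ) + 1 by simp,
    ← hind.affineSpan_eq_top_iff_card_eq_finrank_add_one]
  by_contra hne
  have h0 := MeasureTheory.Measure.addHaar_affineSubspace
    (MeasureTheory.volume : MeasureTheory.Measure (Fin 2 → ℝ)) _ hne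
  have h1 := MeasureTheory.measure_mono_null (convexHull_subset_affineSpan _) h0
  simp only [Subtype.range_coe_subtype, Finset.setOfPred_mem] at h1
  rw [hT.area_eq t ht] at h1
  simp at h1

theorem abs_cross_eq_one_of_facet {T : Geometry.SimplicialComplex ℝ (Fin 2 → ℝ)}
    {P : Set (Fin 2 → ℝ)} (hT : IsUnimodularTriangulation T P) {a b c : Fin 2 → ℝ}
    (ht : ({a, b, c} : Finset (Fin 2 → ℝ)) ∈ T.facets) : |cross (b - a) (c - a)| = 1 := by
  have h := hT.area_eq _ ht
  push_cast at h
  rw [volume_triangle] at h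
  have h2 := congrArg ENNReal.toReal h
  simp only [ENNReal.toReal_mul, ENNReal.toReal_ofReal (abs_nonneg _)] at h2
  norm_num at h2
  exact h2

/-! ### Supporting lines and the boundary of the polygon -/

theorem IsLatticePolygon.convex {P : Set (Fin 2 → ℝ)} (hP : IsLatticePolygon P) : Convex ℝ P := by
  obtain ⟨⟨s, -, rfl⟩, -⟩ := hP
  exact convex_convexHull _ _

theorem IsLatticePolygon.isClosed {P : Set (Fin 2 → ℝ)} (hP : IsLatticePolygon P) :
    IsClosed P := by
  obtain ⟨⟨s, -, rfl⟩, -⟩ := hP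
  exact s.finite_toSet.isClosed_convexHull ℝ

theorem mem_frontier_of_cross_nonneg {P : Set (Fin 2 → ℝ)} (hcl : IsClosed P)
    {v d : Fin 2 → ℝ} (hv : v ∈ P) (hd : d ≠ 0) (h : ∀ x ∈ P, 0 ≤ cross d (x - v)) :
    v ∈ frontier P := by
  rw [hcl.frontier_eq]
  refine ⟨hv, fun hint => ?_⟩
  -- The vector `![d 1, -d 0]` is normal to `d`, and `cross d` takes the value `-(d 0 ^ 2 + d 1 ^
  -- 2)` on it. A small positive step from an interior point would stay in `P` but leave the
  -- half-plane.
  have hcont : Filter.Tendsto (fun ε : ℝ => v + ε • ![d 1, -d 0]) (nhds 0) (nhds v) := by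
    have : Continuous fun ε : ℝ => v + ε • ![d 1, -d 0] := by fun_prop
    simpa using this.tendsto 0
  have hev := hcont (mem_interior_iff_mem_nhds.1 hint)
  obtain ⟨ε, hε0, hε⟩ : ∃ ε > (0 : ℝ), v + ε • ![d 1, -d 0] ∈ P := by
    have h1 : ∀ᶠ ε in nhdsWithin (0 : ℝ) (Set.Ioi 0), v + ε • ![d 1, -d 0] ∈ P :=
      nhdsWithin_le_nhds hev
    obtain ⟨ε, h2, h3⟩ := (h1.and self_mem_nhdsWithin).exists
    exact ⟨ε, h3, h2⟩
  have h1 := h _ hε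
  simp only [cross, add_sub_cancel_left, Pi.smul_apply, Matrix.cons_val_zero, Matrix.cons_val_one,
    smul_eq_mul] at h1
  have h2 : d 0 ^ 2 + d 1 ^ 2 ≤ 0 := by
    by_contra hlt
    push Not at hlt
    nlinarith [mul_pos hε0 hlt]
  have h3 : d 0 = 0 := pow_eq_zero_iff two_ne_zero |>.1 (by
    nlinarith [sq_nonneg (d 0), sq_nonneg (d 1)])
  have h4 : d 1 = 0 := pow_eq_zero_iff two_ne_zero |>.1 (by
    nlinarith [sq_nonneg (d 0), sq_nonneg (d 1)])
  exact hd (funext fun i => by fin_cases i <;> assumption)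

theorem exists_cross_nonneg_of_mem_frontier {P : Set (Fin 2 → ℝ)} (hP : IsLatticePolygon P)
    {v : Fin 2 → ℝ} (hv : v ∈ frontier P) :
    ∃ d : Fin 2 → ℝ, d ≠ 0 ∧ ∀ x ∈ P, 0 ≤ cross d (x - v) := by
  rw [hP.isClosed.frontier_eq] at hv
  obtain ⟨f, hf⟩ := geometric_hahn_banach_open_point hP.convex.interior isOpen_interior hv.2
  have hle : ∀ x ∈ P, f x ≤ f v := by
    have hsub : closure (interior P) ⊆ {x | f x ≤ f v} :=
      closure_minimal (fun x hx => (hf x hx).le) (isClosed_le f.continuous continuous_const)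
    rw [hP.convex.closure_interior_eq_closure_of_nonempty_interior hP.2] at hsub
    exact fun x hx => hsub (subset_closure hx)
  have hfx : ∀ x : Fin 2 → ℝ, f x = x 0 * f (Pi.single 0 1) + x 1 * f (Pi.single 1 1) := by
    intro x
    conv_lhs => rw [show x = x 0 • Pi.single 0 1 + x 1 • Pi.single 1 1 by
      ext i; fin_cases i <;> simp]
    rw [map_add, map_smul, map_smul, smul_eq_mul, smul_eq_mul]
  -- The direction of the level line of `f`, oriented so that `cross d (x - v) = f v - f x`.
  refine ⟨![-f (Pi.single 1 1), f (Pi.single 0 1)], fun h0 => ?_, fun x hx => ?_⟩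
  · obtain ⟨x, hx⟩ := hP.2
    have h1 := hf x hx
    have h2 : f (Pi.single 1 1) = 0 := by simpa using congrFun h0 0
    have h3 : f (Pi.single 0 1) = 0 := by simpa using congrFun h0 1
    rw [hfx x, hfx v, h2, h3] at h1
    simp at h1
  · have h1 := hle x hx
    rw [hfx x, hfx v] at h1
    simp only [cross, Matrix.cons_val_zero, Matrix.cons_val_one, Pi.sub_apply]
    linarith

/-- Otherwise `P` lies on a line, and its interior point would be on its frontier. -/
theorem exists_cross_ne_zero {P : Set (Fin 2 → ℝ)} (hP : IsLatticePolygon P)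
    {d : Fin 2 → ℝ} (hd : d ≠ 0) (v : Fin 2 → ℝ) : ∃ x ∈ P, cross d (x - v) ≠ 0 := by
  by_contra! h
  obtain ⟨u, hu⟩ := hP.2
  have huP := interior_subset hu
  have h1 := mem_frontier_of_cross_nonneg hP.isClosed huP hd fun x hx => by
    have h1 := h x hx
    have h2 := h u huP
    simp only [cross, Pi.sub_apply] at *
    linarith
  rw [hP.isClosed.frontier_eq] at h1
  exact h1.2 hu

theorem exists_smul_eq_of_cross_eq_zero {u v : Fin 2 → ℝ} (hu : u ≠ 0) (h : cross u v = 0) :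
    ∃ c : ℝ, v = c • u := by
  by_cases h0 : u 0 = 0
  · have h1 : u 1 ≠ 0 := fun h1 => hu (funext fun i => by fin_cases i <;> assumption)
    refine ⟨v 1 / u 1, funext fun i => ?_⟩
    have h2 : v 0 = 0 := by
      simp only [cross, h0, zero_mul, zero_sub, neg_eq_zero, mul_eq_zero] at h
      exact h.resolve_left h1
    fin_cases i
    · simp [h0, h2]
    · simp [h1]
  · refine ⟨v 0 / u 0, funext fun i => ?_⟩
    fin_cases i
    · simp [h0]
    · simp only [cross] at h
      simp only [Fin.mk_one, Pi.smul_apply, smul_eq_mul]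
      field_simp
      linarith

/-- The boundary edges are the ones with the polygon on one side. -/
theorem openSegment_subset_frontier_iff {P : Set (Fin 2 → ℝ)} (hP : IsLatticePolygon P)
    {y z : Fin 2 → ℝ} (hyz : y ≠ z) (hy : y ∈ P) (hz : z ∈ P) :
    openSegment ℝ y z ⊆ frontier P ↔
      (∀ x ∈ P, 0 ≤ cross (z - y) (x - y)) ∨ (∀ x ∈ P, 0 ≤ cross (y - z) (x - z)) := by
  have hd : z - y ≠ 0 := sub_ne_zero.2 hyz.symm
  constructor
  · intro h
    have hm : (1 / 2 : ℝ) • y + (1 / 2 : ℝ) • z ∈ frontier P :=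
      h ⟨1 / 2, 1 / 2, by norm_num, by norm_num, by norm_num, rfl⟩
    obtain ⟨d, hd0, hdP⟩ := exists_cross_nonneg_of_mem_frontier hP hm
    have h1 := hdP y hy
    have h2 := hdP z hz
    -- The values at `y` and `z`, taken relative to the midpoint, are opposite and both nonnegative,
    -- hence zero: the supporting line is the line of the edge.
    obtain ⟨c, hc⟩ := exists_smul_eq_of_cross_eq_zero (u := z - y) (v := d) hd (by
      simp only [cross, Pi.sub_apply, Pi.add_apply, Pi.smul_apply, smul_eq_mul] at *
      linarith)
    have key : ∀ x ∈ P, 0 ≤ c * cross (z - y) (x - y) := by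
      intro x hx
      have h3 := hdP x hx
      rw [hc] at h3
      simp only [cross, Pi.sub_apply, Pi.add_apply, Pi.smul_apply, smul_eq_mul] at *
      linarith
    rcases lt_trichotomy c 0 with hc0 | rfl | hc0
    · right
      intro x hx
      have h3 := key x hx
      have h4 : cross (y - z) (x - z) = -cross (z - y) (x - y) := by
        simp only [cross, Pi.sub_apply]
        ring
      rw [h4]
      nlinarith
    · simp [hc] at hd0
    · left
      intro x hx
      exact nonneg_of_mul_nonneg_right (key x hx) hc0
  · rintro h p ⟨r, s, hr, hs, hrs, rfl⟩
    have hmem := hP.convex hy hz hr.le hs.le hrs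
    obtain rfl : r = 1 - s := by linarith
    rcases h with h | h
    · refine mem_frontier_of_cross_nonneg hP.isClosed hmem hd fun x hx => ?_
      have := h x hx
      simp only [cross, Pi.sub_apply, Pi.add_apply, Pi.smul_apply, smul_eq_mul] at *
      linarith
    · refine mem_frontier_of_cross_nonneg hP.isClosed hmem (sub_ne_zero.2 hyz) fun x hx => ?_
      have := h x hx
      simp only [cross, Pi.sub_apply, Pi.add_apply, Pi.smul_apply, smul_eq_mul] at *
      linarith

/-! ### Faces and facets of the triangulation -/

theorem faces_finite {T : Geometry.SimplicialComplex ℝ (Fin 2 → ℝ)}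
    {P : Set (Fin 2 → ℝ)} (hP : IsLatticePolygon P) (hT : IsUnimodularTriangulation T P) :
    T.faces.Finite := by
  have hfin := latticePoints_finite hP.isBounded
  refine (hfin.toFinset.powerset.finite_toSet).subset ?_
  intro e he
  simp only [Finset.mem_coe, Finset.mem_powerset]
  intro x hx
  rw [Set.Finite.mem_toFinset]
  have hv : x ∈ T.vertices :=
    T.down_closed he (Finset.singleton_subset_iff.2 hx) (Finset.singleton_nonempty _)
  exact ⟨hT.space_eq ▸ T.vertices_subset_space hv, hT.vertices_subset hv⟩

theorem mem_of_mem_face {T : Geometry.SimplicialComplex ℝ (Fin 2 → ℝ)}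
    {P : Set (Fin 2 → ℝ)} (hT : IsUnimodularTriangulation T P) {s : Finset (Fin 2 → ℝ)}
    (hs : s ∈ T.faces) {v : Fin 2 → ℝ} (hv : v ∈ s) : v ∈ P :=
  hT.space_eq ▸ T.subset_space hs hv

theorem mem_lattice_of_mem_face {T : Geometry.SimplicialComplex ℝ (Fin 2 → ℝ)}
    {P : Set (Fin 2 → ℝ)} (hT : IsUnimodularTriangulation T P) {s : Finset (Fin 2 → ℝ)}
    (hs : s ∈ T.faces) {v : Fin 2 → ℝ} (hv : v ∈ s) : v ∈ lattice :=
  hT.vertices_subset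
    (T.down_closed hs (Finset.singleton_subset_iff.2 hv) (Finset.singleton_nonempty _))

theorem exists_facet_superset {T : Geometry.SimplicialComplex ℝ (Fin 2 → ℝ)}
    {P : Set (Fin 2 → ℝ)} (hP : IsLatticePolygon P) (hT : IsUnimodularTriangulation T P)
    {s : Finset (Fin 2 → ℝ)} (hs : s ∈ T.faces) : ∃ t ∈ T.facets, s ⊆ t := by
  obtain ⟨t, hst, ht⟩ := (faces_finite hP hT).exists_le_maximal hs
  exact ⟨t, ⟨ht.prop, fun u hu htu => Finset.Subset.antisymm htu (ht.le_of_ge hu htu)⟩, hst⟩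

theorem card_face_le_three {T : Geometry.SimplicialComplex ℝ (Fin 2 → ℝ)}
    {P : Set (Fin 2 → ℝ)} (hP : IsLatticePolygon P) (hT : IsUnimodularTriangulation T P)
    {s : Finset (Fin 2 → ℝ)} (hs : s ∈ T.faces) : s.card ≤ 3 := by
  obtain ⟨t, ht, hst⟩ := exists_facet_superset hP hT hs
  exact (Finset.card_le_card hst).trans (card_facet_eq_three hT ht).le

theorem mem_facets_iff_card {T : Geometry.SimplicialComplex ℝ (Fin 2 → ℝ)}
    {P : Set (Fin 2 → ℝ)} (hP : IsLatticePolygon P) (hT : IsUnimodularTriangulation T P)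
    {s : Finset (Fin 2 → ℝ)} : s ∈ T.facets ↔ s ∈ T.faces ∧ s.card = 3 := by
  refine ⟨fun h => ⟨h.1, card_facet_eq_three hT h⟩, fun ⟨h, hc⟩ => ?_⟩
  obtain ⟨t, ht, hst⟩ := exists_facet_superset hP hT h
  rwa [Finset.eq_of_subset_of_card_le hst (by rw [hc, card_facet_eq_three hT ht])]

theorem exists_mem_facet {T : Geometry.SimplicialComplex ℝ (Fin 2 → ℝ)}
    {P : Set (Fin 2 → ℝ)} (hP : IsLatticePolygon P) (hT : IsUnimodularTriangulation T P)
    {x : Fin 2 → ℝ} (hx : x ∈ P) : ∃ t ∈ T.facets, x ∈ convexHull ℝ (t : Set (Fin 2 → ℝ)) := by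
  rw [← hT.space_eq, Geometry.SimplicialComplex.mem_space_iff] at hx
  obtain ⟨s, hs, hxs⟩ := hx
  obtain ⟨t, ht, hst⟩ := exists_facet_superset hP hT hs
  exact ⟨t, ht, convexHull_mono (Finset.coe_subset.2 hst) hxs⟩

/-- Starting in the relative interior of a face, every direction pointing into the polygon
initially runs inside some triangle that contains the face. -/
theorem exists_facet_toward {T : Geometry.SimplicialComplex ℝ (Fin 2 → ℝ)}
    {P : Set (Fin 2 → ℝ)} (hP : IsLatticePolygon P) (hT : IsUnimodularTriangulation T P)
    {s : Finset (Fin 2 → ℝ)} (hs : s ∈ T.faces) {w : (Fin 2 → ℝ) → ℝ} (hw : ∀ v ∈ s, 0 < w v)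
    (hw1 : ∑ v ∈ s, w v = 1) {p q : Fin 2 → ℝ} (hp : ∑ v ∈ s, w v • v = p) (hq : q ∈ P) :
    ∃ t ∈ T.facets, s ⊆ t ∧ ∃ ε : ℝ, 0 < ε ∧
      p + ε • (q - p) ∈ convexHull ℝ (t : Set (Fin 2 → ℝ)) := by
  have hpP : p ∈ P := by
    rw [← hT.space_eq, Geometry.SimplicialComplex.mem_space_iff]
    exact ⟨s, hs, Finset.mem_convexHull'.2 ⟨w, fun v hv => (hw v hv).le, hw1, hp⟩⟩
  -- A facet not containing `s` misses `p`, and being closed it misses all points close to `p`. With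
  -- finitely many facets one `ε` serves for all.
  have hev : ∀ t ∈ T.facets, ∀ᶠ ε in nhdsWithin (0 : ℝ) (Set.Ioi 0),
      p + ε • (q - p) ∈ convexHull ℝ (t : Set (Fin 2 → ℝ)) → s ⊆ t := by
    intro t ht
    by_cases hst : s ⊆ t
    · exact Filter.Eventually.of_forall fun _ _ => hst
    · have hpt : p ∉ convexHull ℝ (t : Set (Fin 2 → ℝ)) := fun h =>
        hst (subset_of_pos_combination_mem hs ht.1 hw hw1 (hp ▸ h))
      have hopen : IsOpen (convexHull ℝ (t : Set (Fin 2 → ℝ)))ᶜ :=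
        (t.finite_toSet.isClosed_convexHull ℝ).isOpen_compl
      have hcont : Continuous fun ε : ℝ => p + ε • (q - p) := by fun_prop
      have h0 : ∀ᶠ ε in nhds (0 : ℝ), p + ε • (q - p) ∈ (convexHull ℝ (t : Set (Fin 2 → ℝ)))ᶜ :=
        hcont.continuousAt.eventually_mem (by simpa using hopen.mem_nhds hpt)
      filter_upwards [nhdsWithin_le_nhds h0] with ε h1 h2
      exact absurd h2 h1
  have hfin : T.facets.Finite :=
    (faces_finite hP hT).subset Geometry.SimplicialComplex.facets_subset
  have h1 := (hfin.eventually_all).2 hev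
  have h2 : ∀ᶠ ε in nhdsWithin (0 : ℝ) (Set.Ioi 0), ε < 1 :=
    nhdsWithin_le_nhds (eventually_lt_nhds one_pos)
  obtain ⟨ε, h3, h4, h5⟩ := (h1.and (h2.and self_mem_nhdsWithin)).exists
  obtain ⟨t, ht, hmem⟩ := exists_mem_facet hP hT
    (hP.convex.add_smul_sub_mem hpP hq ⟨le_of_lt h5, h4.le⟩)
  exact ⟨t, ht, h3 t ht hmem, ε, h5, hmem⟩

/-! ### Triangles along an edge -/

theorem exists_eq_insert_pair {t : Finset (Fin 2 → ℝ)} (ht : t.card = 3) {y z : Fin 2 → ℝ}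
    (hyz : y ≠ z) (hy : y ∈ t) (hz : z ∈ t) : ∃ a, a ≠ y ∧ a ≠ z ∧ t = {y, z, a} := by
  have h1 : ({y, z} : Finset (Fin 2 → ℝ)) ⊆ t := by
    simp [Finset.insert_subset_iff, hy, hz]
  have h2 : (t \ {y, z}).card = 1 := by
    rw [Finset.card_sdiff_of_subset h1, ht, Finset.card_pair hyz]
  obtain ⟨a, ha⟩ := Finset.card_eq_one.1 h2
  have h3 : a ∈ t \ {y, z} := ha ▸ Finset.mem_singleton_self a
  simp only [Finset.mem_sdiff, Finset.mem_insert, Finset.mem_singleton, not_or] at h3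
  refine ⟨a, h3.2.1, h3.2.2, ?_⟩
  rw [← Finset.sdiff_union_of_subset h1, ha]
  ext x
  simp only [Finset.mem_union, Finset.mem_insert, Finset.mem_singleton]
  tauto

/-- An edge has at most one triangle on each side. -/
theorem eq_of_same_side {T : Geometry.SimplicialComplex ℝ (Fin 2 → ℝ)} {y z a b : Fin 2 → ℝ}
    (hyz : y ≠ z) (ha : ({y, z, a} : Finset (Fin 2 → ℝ)) ∈ T.faces)
    (hb : ({y, z, b} : Finset (Fin 2 → ℝ)) ∈ T.faces)
    (hab : 0 < cross (z - y) (a - y) * cross (z - y) (b - y)) : a = b := by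
  have hcy : ∀ x : Fin 2 → ℝ, cross (z - y) (x - y) ≠ 0 → x ≠ y ∧ x ≠ z := by
    rintro x hx
    refine ⟨?_, ?_⟩ <;> rintro rfl <;> refine hx ?_ <;> simp only [cross, Pi.sub_apply] <;> ring
  have ha0 : cross (z - y) (a - y) ≠ 0 := left_ne_zero_of_mul hab.ne'
  have hb0 : cross (z - y) (b - y) ≠ 0 := right_ne_zero_of_mul hab.ne'
  obtain ⟨hay, haz⟩ := hcy a ha0
  obtain ⟨hby, hbz⟩ := hcy b hb0
  -- The ratio of the signed heights over the edge, so that `b - y - q • (a - y)` is parallel to the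
  -- edge; `q` is positive because the sides agree.
  set q := cross (z - y) (b - y) / cross (z - y) (a - y) with hq
  have hq0 : 0 < q := by
    rcases mul_pos_iff.1 hab with h | h
    · exact div_pos h.2 h.1
    · exact div_pos_of_neg_of_neg h.2 h.1
  obtain ⟨p, hp⟩ := exists_smul_eq_of_cross_eq_zero (u := z - y)
    (v := (b - y) - q • (a - y)) (sub_ne_zero.2 hyz.symm) (by
      have : cross (z - y) ((b - y) - q • (a - y)) =
          cross (z - y) (b - y) - q * cross (z - y) (a - y) := by
        simp only [cross, Pi.sub_apply, Pi.smul_apply, smul_eq_mul]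
        ring
      rw [this, hq]
      field_simp
      ring)
  have hbeq : b = (1 - p - q) • y + p • z + q • a := by
    have : b = y + q • (a - y) + p • (z - y) := by
      rw [← hp]
      abel
    rw [this]
    module
  -- The point `(1 - ε)` times the midpoint of the edge plus `ε • b` has positive weights in `{y, z,
  -- b}`. This `ε` is small enough that its weights in `{y, z, a}` are positive too, so the two
  -- triangles coincide.
  set ε : ℝ := 1 / (2 * (1 + |p| + q)) with hε
  have hε0 : 0 < ε := by positivity
  have hε1 : ε * (2 * (1 + |p| + q)) = 1 := by
    rw [hε]
    field_simp
  have hp1 := le_abs_self p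
  have hp2 := neg_abs_le p
  have hεp : ε * p ≤ ε * |p| := mul_le_mul_of_nonneg_left hp1 hε0.le
  have hεp' : ε * -|p| ≤ ε * p := mul_le_mul_of_nonneg_left hp2 hε0.le
  have hεq : 0 < ε * q := by positivity
  have hεa : 0 ≤ ε * |p| := by positivity
  have htri : ∀ x : Fin 2 → ℝ, x ≠ y → x ≠ z → ∀ {M : Type} [AddCommMonoid M]
      (f : (Fin 2 → ℝ) → M), ∑ v ∈ {y, z, x}, f v = f y + (f z + f x) := by
    intro x hxy hxz M _ f
    rw [Finset.sum_insert (by simp [hyz, hxy.symm]), Finset.sum_pair hxz.symm]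
  have hwt : ∀ x : Fin 2 → ℝ, x ≠ y → x ≠ z → ∀ r s u : ℝ, ∃ w : (Fin 2 → ℝ) → ℝ,
      w y = r ∧ w z = s ∧ w x = u := by
    intro x hxy hxz r s u
    exact ⟨fun v => if v = y then r else if v = z then s else u,
      by simp, by simp [hyz.symm], by simp [hxy, hxz]⟩
  obtain ⟨w, hw1, hw2, hw3⟩ := hwt a hay haz ((1 - ε) / 2 + ε * (1 - p - q))
    ((1 - ε) / 2 + ε * p) (ε * q)
  obtain ⟨w', hw1', hw2', hw3'⟩ := hwt b hby hbz ((1 - ε) / 2) ((1 - ε) / 2) ε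
  have heq := (eq_of_pos_combination_eq ha hb (w := w) (w' := w')
    (by
      intro v hv
      simp only [Finset.mem_insert, Finset.mem_singleton] at hv
      rcases hv with rfl | rfl | rfl
      · rw [hw1]; linarith
      · rw [hw2]; linarith
      · rw [hw3]; linarith)
    (by rw [htri a hay haz, hw1, hw2, hw3]; ring)
    (by
      intro v hv
      simp only [Finset.mem_insert, Finset.mem_singleton] at hv
      rcases hv with rfl | rfl | rfl
      · rw [hw1']; linarith
      · rw [hw2']; linarith
      · rw [hw3']; linarith)
    (by rw [htri b hby hbz, hw1', hw2', hw3']; ring)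
    (by
      rw [htri a hay haz, htri b hby hbz, hw1, hw2, hw3, hw1', hw2', hw3', hbeq]
      module)).1
  have hmem : a ∈ ({y, z, b} : Finset (Fin 2 → ℝ)) := heq ▸ by simp
  simpa [hay, haz] using hmem

/-- An edge has a triangle on each side on which there are points of the polygon. -/
theorem exists_triangle_on_side {T : Geometry.SimplicialComplex ℝ (Fin 2 → ℝ)}
    {P : Set (Fin 2 → ℝ)} (hP : IsLatticePolygon P) (hT : IsUnimodularTriangulation T P)
    {y z q : Fin 2 → ℝ} (hyz : y ≠ z) (he : ({y, z} : Finset (Fin 2 → ℝ)) ∈ T.faces)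
    (hq : q ∈ P) (hq0 : cross (z - y) (q - y) ≠ 0) :
    ∃ a, {y, z, a} ∈ T.facets ∧ 0 < cross (z - y) (a - y) * cross (z - y) (q - y) := by
  obtain ⟨t, ht, hst, ε, hε, hmem⟩ := exists_facet_toward hP hT he (w := fun _ => 1 / 2)
    (by norm_num) (by rw [Finset.sum_pair hyz]; norm_num) rfl hq
  obtain ⟨a, -, -, rfl⟩ := exists_eq_insert_pair (card_facet_eq_three hT ht) hyz
    (hst (by simp)) (hst (by simp))
  refine ⟨a, ht, ?_⟩
  push_cast at hmem
  obtain ⟨α, β, -, hβ, -, h⟩ := mem_convexHull_triple.1 hmem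
  rw [Finset.sum_pair hyz] at h
  have h0 := congrFun h 0
  have h1 := congrFun h 1
  simp only [Pi.add_apply, Pi.smul_apply, Pi.sub_apply, smul_eq_mul] at h0 h1
  -- Pairing with `z - y` kills the components along the edge; only the weight `β` of the third
  -- vertex survives.
  have key : ε * cross (z - y) (q - y) = β * cross (z - y) (a - y) := by
    simp only [cross, Pi.sub_apply]
    linear_combination (z 0 - y 0) * h1 - (z 1 - y 1) * h0
  have hβ0 : 0 < β := by
    refine hβ.lt_of_ne ?_
    rintro rfl
    rw [zero_mul] at key
    exact mul_ne_zero hε.ne' hq0 key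
  have h2 : 0 < ε * cross (z - y) (q - y) ^ 2 := by positivity
  have h3 : ε * cross (z - y) (q - y) ^ 2 =
      β * (cross (z - y) (a - y) * cross (z - y) (q - y)) := by
    rw [pow_two, ← mul_assoc, key]
    ring
  rw [h3] at h2
  exact pos_of_mul_pos_right h2 hβ

/-! ### Boundary edges at a vertex -/

/-- At a boundary point the polygon has an extreme direction on either side. -/
theorem exists_extreme_direction {P : Set (Fin 2 → ℝ)} (hP : IsLatticePolygon P)
    {v : Fin 2 → ℝ} (hv : v ∈ frontier P) {σ : ℝ} :
    ∃ z ∈ P, z ≠ v ∧ ∀ x ∈ P, 0 ≤ σ * cross (z - v) (x - v) := by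
  obtain ⟨d, hd, hdP⟩ := exists_cross_nonneg_of_mem_frontier hP hv
  obtain ⟨x₀, hx₀, hne⟩ := exists_cross_ne_zero hP hd v
  obtain ⟨⟨s, -, rfl⟩, -⟩ := hP
  have hsP : ∀ x ∈ s, x ∈ convexHull ℝ (s : Set (Fin 2 → ℝ)) := fun x hx =>
    subset_convexHull ℝ _ hx
  have hhull : ∀ u : Fin 2 → ℝ, ∀ c : ℝ, (∀ x ∈ s, 0 ≤ c * cross u (x - v)) →
      ∀ x ∈ convexHull ℝ (s : Set (Fin 2 → ℝ)), 0 ≤ c * cross u (x - v) := by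
    intro u c h x hx
    refine convexHull_min (t := {x | 0 ≤ c * cross u (x - v)}) h ?_ hx
    intro x hx y hy a b ha hb hab
    have h1 : c * cross u (a • x + b • y - v) =
        a * (c * cross u (x - v)) + b * (c * cross u (y - v)) := by
      obtain rfl : b = 1 - a := by linarith
      simp only [cross, Pi.sub_apply, Pi.add_apply, Pi.smul_apply, smul_eq_mul]
      ring
    change 0 ≤ c * cross u (a • x + b • y - v)
    rw [h1]
    exact add_nonneg (mul_nonneg ha hx) (mul_nonneg hb hy)
  -- The coordinate along the supporting line, reversed for negative `σ`. With `cross d (x - v)` as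
  -- height, `hid` rewrites the wanted determinant in these coordinates.
  set X : (Fin 2 → ℝ) → ℝ := fun x => σ * (d 0 * (x 0 - v 0) + d 1 * (x 1 - v 1)) with hX
  have hD : 0 < d 0 ^ 2 + d 1 ^ 2 := by
    by_contra hlt
    refine hd (funext fun i => ?_)
    have h0 : d 0 = 0 := pow_eq_zero_iff two_ne_zero |>.1 (by
      nlinarith [sq_nonneg (d 0), sq_nonneg (d 1)])
    have h1 : d 1 = 0 := pow_eq_zero_iff two_ne_zero |>.1 (by
      nlinarith [sq_nonneg (d 0), sq_nonneg (d 1)])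
    fin_cases i <;> assumption
  have hid : ∀ z x : Fin 2 → ℝ, (d 0 ^ 2 + d 1 ^ 2) * (σ * cross (z - v) (x - v)) =
      X z * cross d (x - v) - cross d (z - v) * X x := by
    intro z x
    simp only [hX, cross, Pi.sub_apply]
    ring
  have hself : cross d (v - v) = 0 := by simp [cross]
  -- If a generator lies on the supporting line on the positive side of `v`, it gives the extreme
  -- direction. Otherwise a generator of positive height maximizing `X` over height does.
  by_cases hA : ∃ w ∈ s, cross d (w - v) = 0 ∧ 0 < X w
  · obtain ⟨w, hws, hw0, hwX⟩ := hA
    refine ⟨w, hsP w hws, ?_, hhull _ _ fun x hx => ?_⟩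
    · rintro rfl
      simp [hX] at hwX
    · refine nonneg_of_mul_nonneg_right (a := d 0 ^ 2 + d 1 ^ 2) ?_ hD
      rw [hid, hw0, zero_mul, sub_zero]
      exact mul_nonneg hwX.le (hdP x (hsP x hx))
  · push Not at hA
    have hne' : (s.filter fun x => 0 < cross d (x - v)).Nonempty := by
      by_contra hemp
      rw [Finset.not_nonempty_iff_eq_empty, Finset.filter_eq_empty_iff] at hemp
      have h1 := hhull d (-1) (fun x hx => by linarith [not_lt.1 (hemp hx)]) x₀ hx₀
      exact hne (le_antisymm (by linarith) (hdP x₀ hx₀))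
    obtain ⟨z, hz, hmax⟩ := Finset.exists_max_image _ (fun x => X x / cross d (x - v)) hne'
    rw [Finset.mem_filter] at hz
    refine ⟨z, hsP z hz.1, ?_, hhull _ _ fun x hx => ?_⟩
    · rintro rfl
      exact hz.2.ne' hself
    · refine nonneg_of_mul_nonneg_right (a := d 0 ^ 2 + d 1 ^ 2) ?_ hD
      rw [hid]
      rcases (hdP x (hsP x hx)).eq_or_lt with h0 | h0
      · have := hA x hx h0.symm
        rw [← h0]
        nlinarith [hz.2]
      · have := hmax x (Finset.mem_filter.2 ⟨hx, h0⟩)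
        rw [div_le_div_iff₀ h0 hz.2] at this
        linarith

/-- The extreme ray from `v` starts inside some triangle `{v, a, b}`. Since `a` and `b` lie on the
allowed side of that ray, it cannot run strictly between them, so it follows an edge. The sign of
`σ` selects one of the two extreme directions. -/
theorem exists_boundary_neighbor {T : Geometry.SimplicialComplex ℝ (Fin 2 → ℝ)}
    {P : Set (Fin 2 → ℝ)} (hP : IsLatticePolygon P) (hT : IsUnimodularTriangulation T P)
    {v : Fin 2 → ℝ} (hvT : v ∈ T.vertices) (hv : v ∈ frontier P) {σ : ℝ} (hσ : σ ≠ 0) :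
    ∃ z, z ≠ v ∧ {v, z} ∈ T.faces ∧ ∀ x ∈ P, 0 ≤ σ * cross (z - v) (x - v) := by
  obtain ⟨q, hqP, hqv, hq⟩ := exists_extreme_direction hP hv (σ := σ)
  obtain ⟨t, ht, hst, ε, hε, hmem⟩ := exists_facet_toward hP hT hvT (w := fun _ => 1)
    (p := v) (by norm_num) (by simp) (by simp) hqP
  have hvt : v ∈ t := hst (by simp)
  obtain ⟨a, hat, hav⟩ := t.exists_mem_ne (by rw [card_facet_eq_three hT ht]; norm_num) v
  obtain ⟨b, hbv, -, rfl⟩ := exists_eq_insert_pair (card_facet_eq_three hT ht) hav.symm hvt hat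
  push_cast at hmem
  obtain ⟨α, β, hα, hβ, -, h⟩ := mem_convexHull_triple.1 hmem
  have h0 := congrFun h 0
  have h1 := congrFun h 1
  simp only [Pi.add_apply, Pi.smul_apply, Pi.sub_apply, smul_eq_mul] at h0 h1
  have hC : cross (a - v) (b - v) ≠ 0 := by
    have := abs_cross_eq_one_of_facet hT ht
    intro h0
    rw [h0] at this
    norm_num at this
  have hcross : ∀ x : Fin 2 → ℝ, ε * (σ * cross (q - v) (x - v)) =
      α * (σ * cross (a - v) (x - v)) + β * (σ * cross (b - v) (x - v)) := by
    intro x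
    simp only [cross, Pi.sub_apply]
    linear_combination σ * (x 1 - v 1) * h0 - σ * (x 0 - v 0) * h1
  have haP : a ∈ P := mem_of_mem_face hT ht.1 (by simp)
  have hbP : b ∈ P := mem_of_mem_face hT ht.1 (by simp)
  have ha1 := mul_nonneg hε.le (hq a haP)
  have hb1 := mul_nonneg hε.le (hq b hbP)
  have hself : ∀ u : Fin 2 → ℝ, cross u u = 0 := fun u => by simp only [cross]; ring
  have hanti : cross (b - v) (a - v) = -cross (a - v) (b - v) := by simp only [cross]; ring
  rw [hcross, hself, hanti] at ha1
  rw [hcross, hself] at hb1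
  have hzero : ¬ (α = 0 ∧ β = 0) := by
    rintro ⟨rfl, rfl⟩
    refine hqv (funext fun i => ?_)
    have h2 := congrFun h i
    have h3 : ε * (q i - v i) = 0 := by
      simp only [zero_smul, Pi.add_apply, Pi.smul_apply, Pi.sub_apply, Pi.zero_apply,
        smul_eq_mul] at h2
      linarith
    linarith [(mul_eq_zero.1 h3).resolve_left hε.ne']
  -- By `ha1` and `hb1`, the orientation of the triangle relative to `σ` decides which coefficient
  -- vanishes.
  rcases (mul_ne_zero hσ hC).lt_or_gt with hneg | hpos
  · obtain rfl : α = 0 := le_antisymm (by nlinarith) hα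
    have hβ0 : 0 < β := hβ.lt_of_ne fun h => hzero ⟨rfl, h.symm⟩
    refine ⟨b, hbv, T.down_closed ht.1 (by intro x; simp; tauto) (by simp), fun x hx => ?_⟩
    have := mul_nonneg hε.le (hq x hx)
    rw [hcross, zero_mul, zero_add] at this
    exact nonneg_of_mul_nonneg_right this hβ0
  · obtain rfl : β = 0 := le_antisymm (by nlinarith) hβ
    have hα0 : 0 < α := hα.lt_of_ne fun h => hzero ⟨h.symm, rfl⟩
    refine ⟨a, hav, T.down_closed ht.1 (by intro x; simp; tauto) (by simp), fun x hx => ?_⟩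
    have := mul_nonneg hε.le (hq x hx)
    rw [hcross, zero_mul, add_zero] at this
    exact nonneg_of_mul_nonneg_right this hα0

/-- Each neighbour lies on the allowed side of the other, so antisymmetry makes the two directions
parallel. Opposite directions would flatten `P`; equal ones make the open edges overlap. -/
theorem boundary_neighbor_unique {T : Geometry.SimplicialComplex ℝ (Fin 2 → ℝ)}
    {P : Set (Fin 2 → ℝ)} (hP : IsLatticePolygon P) (hT : IsUnimodularTriangulation T P)
    {v z z' : Fin 2 → ℝ} {σ : ℝ} (hσ : σ ≠ 0) (hz : z ≠ v) (hz' : z' ≠ v)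
    (he : ({v, z} : Finset (Fin 2 → ℝ)) ∈ T.faces)
    (he' : ({v, z'} : Finset (Fin 2 → ℝ)) ∈ T.faces)
    (h : ∀ x ∈ P, 0 ≤ σ * cross (z - v) (x - v))
    (h' : ∀ x ∈ P, 0 ≤ σ * cross (z' - v) (x - v)) : z = z' := by
  have h1 := h z' (mem_of_mem_face hT he' (by simp))
  have h2 := h' z (mem_of_mem_face hT he (by simp))
  have hanti : cross (z' - v) (z - v) = -cross (z - v) (z' - v) := by simp only [cross]; ring
  rw [hanti] at h2
  have h3 : cross (z - v) (z' - v) = 0 :=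
    (mul_eq_zero.1 (le_antisymm (by linarith) h1)).resolve_left hσ
  obtain ⟨c, hc⟩ := exists_smul_eq_of_cross_eq_zero (sub_ne_zero.2 hz) h3
  have hcc : ∀ x : Fin 2 → ℝ, cross (z' - v) x = c * cross (z - v) x := fun x => by
    rw [hc]
    simp only [cross, Pi.smul_apply, smul_eq_mul]
    ring
  have hc0 : 0 < c := by
    rcases lt_trichotomy c 0 with hneg | rfl | hpos
    · obtain ⟨x, hx, hx0⟩ := exists_cross_ne_zero hP (sub_ne_zero.2 hz) v
      have h4 := h x hx
      have h5 := h' x hx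
      rw [hcc] at h5
      have h6 : σ * cross (z - v) (x - v) = 0 := le_antisymm (by nlinarith) h4
      exact absurd h6 (mul_ne_zero hσ hx0)
    · exact absurd (by simpa [sub_eq_zero] using hc) hz'
    · exact hpos
  have hp : ∀ y : Fin 2 → ℝ, y ≠ v → ∀ δ : ℝ, 0 < δ → δ < 1 →
      ∃ w : (Fin 2 → ℝ) → ℝ, (∀ u ∈ ({v, y} : Finset (Fin 2 → ℝ)), 0 < w u) ∧
        ∑ u ∈ {v, y}, w u = 1 ∧ ∑ u ∈ {v, y}, w u • u = v + δ • (y - v) := by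
    intro y hy δ hδ0 hδ1
    refine ⟨fun u => if u = v then 1 - δ else δ, fun u hu => ?_, ?_, ?_⟩
    · dsimp only
      split_ifs <;> linarith
    · rw [Finset.sum_pair hy.symm]
      simp [hy]
    · rw [Finset.sum_pair hy.symm]
      simp only [if_true, hy, if_false]
      module
  -- As `z' - v = c • (z - v)`, the parameters `c / (1 + c)` and `1 / (1 + c)` give the same point,
  -- inside both open edges for every `c > 0`.
  obtain ⟨w, hw, hw1, hw2⟩ := hp z hz (c / (1 + c)) (by positivity)
    (by rw [div_lt_one (by positivity)]; linarith)
  obtain ⟨w', hw', hw1', hw2'⟩ := hp z' hz' (1 / (1 + c)) (by positivity)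
    (by rw [div_lt_one (by positivity)]; linarith)
  have heq := (eq_of_pos_combination_eq he he' hw hw1 hw' hw1' (by
    rw [hw2, hw2', hc, smul_smul]
    congr 2
    ring)).1
  have hmem : z ∈ ({v, z'} : Finset (Fin 2 → ℝ)) := heq ▸ by simp
  simpa [hz] using hmem

/-- The factors `1` and `-1` are the values of `σ` used for the two boundary neighbours of a vertex.
-/
theorem pair_notMem_interiorEdges_iff {T : Geometry.SimplicialComplex ℝ (Fin 2 → ℝ)}
    {P : Set (Fin 2 → ℝ)} (hP : IsLatticePolygon P) (hT : IsUnimodularTriangulation T P)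
    {y z : Fin 2 → ℝ} (hyz : z ≠ y) (he : ({y, z} : Finset (Fin 2 → ℝ)) ∈ T.faces) :
    ({y, z} : Finset (Fin 2 → ℝ)) ∉ interiorEdges T P ↔
      (∀ x ∈ P, 0 ≤ 1 * cross (z - y) (x - y)) ∨ (∀ x ∈ P, 0 ≤ -1 * cross (z - y) (x - y)) := by
  have h1 : ∀ x : Fin 2 → ℝ, -1 * cross (z - y) (x - y) = cross (y - z) (x - z) := fun x => by
    simp only [cross, Pi.sub_apply]
    ring
  simp only [h1, one_mul]
  rw [← openSegment_subset_frontier_iff hP hyz.symm (mem_of_mem_face hT he (by simp))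
    (mem_of_mem_face hT he (by simp)), not_iff_comm]
  constructor
  · intro h
    exact ⟨he, y, z, hyz.symm, by simp, h⟩
  · rintro ⟨-, a, b, -, hab, h⟩
    push_cast at hab
    rcases Set.pair_eq_pair_iff.1 hab with ⟨rfl, rfl⟩ | ⟨rfl, rfl⟩
    · exact h
    · rwa [openSegment_symm]

/-! ### Incidence counts -/

open scoped Classical in
/-- Every boundary vertex lies on exactly two boundary edges. -/
theorem card_boundary_edges_at {T : Geometry.SimplicialComplex ℝ (Fin 2 → ℝ)}
    {P : Set (Fin 2 → ℝ)} (hP : IsLatticePolygon P) (hT : IsUnimodularTriangulation T P)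
    {v : Fin 2 → ℝ} (hvT : v ∈ T.vertices) {B : Finset (Finset (Fin 2 → ℝ))}
    (hB : ∀ e, e ∈ B ↔ (e ∈ T.faces ∧ e.card = 2) ∧ e ∉ interiorEdges T P) :
    (B.filter fun e => v ∈ e).card = if v ∈ frontier P then 2 else 0 := by
  have hother : ∀ e ∈ B, v ∈ e → ∃ z, z ≠ v ∧ e = {v, z} ∧ {v, z} ∈ T.faces ∧
      ((∀ x ∈ P, 0 ≤ 1 * cross (z - v) (x - v)) ∨
        (∀ x ∈ P, 0 ≤ -1 * cross (z - v) (x - v))) := by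
    intro e he hve
    obtain ⟨⟨hef, hec⟩, hei⟩ := (hB e).1 he
    obtain ⟨z, hze, hzv⟩ := e.exists_mem_ne (by rw [hec]; norm_num) v
    have h1 : ({v, z} : Finset (Fin 2 → ℝ)) = e :=
      Finset.eq_of_subset_of_card_le (by simp [Finset.insert_subset_iff, hve, hze])
        (by rw [hec, Finset.card_pair hzv.symm])
    subst h1
    exact ⟨z, hzv, rfl, hef, (pair_notMem_interiorEdges_iff hP hT hzv hef).1 hei⟩
  split_ifs with hv
  · obtain ⟨z₁, hz₁, he₁, h₁⟩ := exists_boundary_neighbor hP hT hvT hv one_ne_zero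
    obtain ⟨z₂, hz₂, he₂, h₂⟩ := exists_boundary_neighbor hP hT hvT hv (neg_ne_zero.2 one_ne_zero)
    -- A common neighbour for both signs would put all of `P` on one line.
    have hne : z₁ ≠ z₂ := by
      rintro rfl
      obtain ⟨x, hx, hx0⟩ := exists_cross_ne_zero hP (sub_ne_zero.2 hz₁) v
      exact hx0 (le_antisymm (by linarith [h₂ x hx]) (by linarith [h₁ x hx]))
    have : B.filter (fun e => v ∈ e) = {{v, z₁}, {v, z₂}} := by
      ext e
      simp only [Finset.mem_filter, Finset.mem_insert, Finset.mem_singleton]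
      constructor
      · rintro ⟨he, hve⟩
        obtain ⟨z, hzv, rfl, hef, h | h⟩ := hother e he hve
        · left
          rw [boundary_neighbor_unique hP hT one_ne_zero hzv hz₁ hef he₁ h h₁]
        · right
          rw [boundary_neighbor_unique hP hT (neg_ne_zero.2 one_ne_zero) hzv hz₂ hef he₂ h h₂]
      · rintro (rfl | rfl)
        · exact ⟨(hB _).2 ⟨⟨he₁, Finset.card_pair hz₁.symm⟩,
            (pair_notMem_interiorEdges_iff hP hT hz₁ he₁).2 (Or.inl h₁)⟩, by simp⟩
        · exact ⟨(hB _).2 ⟨⟨he₂, Finset.card_pair hz₂.symm⟩,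
            (pair_notMem_interiorEdges_iff hP hT hz₂ he₂).2 (Or.inr h₂)⟩, by simp⟩
    rw [this, Finset.card_pair]
    intro heq
    have hmem : z₁ ∈ ({v, z₂} : Finset (Fin 2 → ℝ)) := heq ▸ by simp
    simp [hz₁, hne] at hmem
  · rw [Finset.card_eq_zero, Finset.filter_eq_empty_iff]
    intro e he hve
    obtain ⟨z, hzv, rfl, hef, h⟩ := hother e he hve
    have hvP : v ∈ P := mem_of_mem_face hT hef (by simp)
    rcases h with h | h
    · exact hv (mem_frontier_of_cross_nonneg hP.isClosed hvP (sub_ne_zero.2 hzv)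
        fun x hx => by simpa using h x hx)
    · refine hv (mem_frontier_of_cross_nonneg hP.isClosed hvP (sub_ne_zero.2 hzv.symm)
        fun x hx => ?_)
      have := h x hx
      simp only [cross, Pi.sub_apply] at *
      linarith

open scoped Classical in
/-- Interior edges lie in two triangles, boundary edges in one. -/
theorem card_triangles_containing {T : Geometry.SimplicialComplex ℝ (Fin 2 → ℝ)}
    {P : Set (Fin 2 → ℝ)} (hP : IsLatticePolygon P) (hT : IsUnimodularTriangulation T P)
    {e : Finset (Fin 2 → ℝ)} (he : e ∈ T.faces) (hec : e.card = 2)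
    {F : Finset (Finset (Fin 2 → ℝ))} (hF : ∀ t, t ∈ F ↔ t ∈ T.facets) :
    (F.filter fun t => e ⊆ t).card = if e ∈ interiorEdges T P then 2 else 1 := by
  obtain ⟨y, z, hyz, rfl⟩ := Finset.card_eq_two.1 hec
  have hthird : ∀ t ∈ F, ({y, z} : Finset (Fin 2 → ℝ)) ⊆ t → ∃ a, t = {y, z, a} ∧
      {y, z, a} ∈ T.facets ∧ a ∈ P ∧ cross (z - y) (a - y) ≠ 0 := by
    intro t ht hst
    rw [hF] at ht
    obtain ⟨a, -, -, rfl⟩ := exists_eq_insert_pair (card_facet_eq_three hT ht) hyz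
      (hst (by simp)) (hst (by simp))
    refine ⟨a, rfl, ht, mem_of_mem_face hT ht.1 (by simp), fun h0 => ?_⟩
    have := abs_cross_eq_one_of_facet hT ht
    rw [h0] at this
    norm_num at this
  have hsub : ∀ a : Fin 2 → ℝ, ({y, z} : Finset (Fin 2 → ℝ)) ⊆ {y, z, a} := by
    intro a x
    simp
    tauto
  have hiff := pair_notMem_interiorEdges_iff hP hT hyz.symm he
  split_ifs with hint
  · have h1 := mt hiff.2 (not_not.2 hint)
    push Not at h1
    obtain ⟨⟨q, hq, hq0⟩, r, hr, hr0⟩ := h1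
    obtain ⟨a, hat, ha⟩ := exists_triangle_on_side hP hT hyz he hq (by linarith)
    obtain ⟨b, hbt, hb⟩ := exists_triangle_on_side hP hT hyz he hr (by linarith)
    have ha0 : cross (z - y) (a - y) < 0 := by
      by_contra h
      nlinarith
    have hb0 : 0 < cross (z - y) (b - y) := by
      by_contra h
      nlinarith
    have : F.filter (fun t => {y, z} ⊆ t) = {{y, z, a}, {y, z, b}} := by
      ext t
      simp only [Finset.mem_filter, Finset.mem_insert, Finset.mem_singleton]
      constructor
      · rintro ⟨ht, hst⟩
        obtain ⟨c, rfl, hct, -, hc⟩ := hthird t ht hst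
        rcases hc.lt_or_gt with hc | hc
        · left
          rw [eq_of_same_side hyz hct.1 hat.1 (mul_pos_of_neg_of_neg hc ha0)]
        · right
          rw [eq_of_same_side hyz hct.1 hbt.1 (mul_pos hc hb0)]
      · rintro (rfl | rfl)
        · exact ⟨(hF _).2 hat, hsub a⟩
        · exact ⟨(hF _).2 hbt, hsub b⟩
    rw [this, Finset.card_pair]
    intro heq
    have hmem : a ∈ ({y, z, b} : Finset (Fin 2 → ℝ)) := heq ▸ by simp
    simp only [Finset.mem_insert, Finset.mem_singleton] at hmem
    rcases hmem with rfl | rfl | rfl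
    · simp [cross] at ha0
    · refine ha0.ne ?_
      simp only [cross]
      ring
    · linarith
  · have h1 := hiff.1 hint
    obtain ⟨q, hq, hq0⟩ := exists_cross_ne_zero hP (sub_ne_zero.2 hyz.symm) y
    obtain ⟨a, hat, ha⟩ := exists_triangle_on_side hP hT hyz he hq hq0
    refine Finset.card_eq_one.2 ⟨{y, z, a}, ?_⟩
    ext t
    simp only [Finset.mem_filter, Finset.mem_singleton]
    constructor
    · rintro ⟨ht, hst⟩
      obtain ⟨c, rfl, hct, hcP, hc⟩ := hthird t ht hst
      have haP : a ∈ P := mem_of_mem_face hT hat.1 (by simp)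
      have ha0 : cross (z - y) (a - y) ≠ 0 := left_ne_zero_of_mul ha.ne'
      -- All of `P` is on one side of a boundary edge, so any two third vertices are on the same
      -- side.
      have hpos : 0 < cross (z - y) (c - y) * cross (z - y) (a - y) := by
        refine (mul_ne_zero hc ha0).symm.lt_of_le ?_
        rcases h1 with h | h
        · have h2 := h a haP
          have h3 := h c hcP
          rw [one_mul] at h2 h3
          exact mul_nonneg h3 h2
        · have h2 := h a haP
          have h3 := h c hcP
          exact mul_nonneg_of_nonpos_of_nonpos (by linarith) (by linarith)
      rw [eq_of_same_side hyz hct.1 hat.1 hpos]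
    · rintro rfl
      exact ⟨(hF _).2 hat, hsub a⟩

/-! ### Lattice points of dilates as weighted sums -/

/-- The barycentric coordinates of a lattice point in a unimodular triangle are integers. -/
theorem exists_nat_weight {T : Geometry.SimplicialComplex ℝ (Fin 2 → ℝ)}
    {P : Set (Fin 2 → ℝ)} (hT : IsUnimodularTriangulation T P) {t : Finset (Fin 2 → ℝ)}
    (ht : t ∈ T.facets) {n : ℕ} {w : (Fin 2 → ℝ) → ℝ} (hw : ∀ v ∈ t, 0 ≤ w v)
    (hw1 : ∑ v ∈ t, w v = n) (hx : ∑ v ∈ t, w v • v ∈ lattice) {v : Fin 2 → ℝ} (hv : v ∈ t) :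
    ∃ m : ℕ, w v = m := by
  obtain ⟨a, hat, hav⟩ := t.exists_mem_ne (by rw [card_facet_eq_three hT ht]; norm_num) v
  obtain ⟨b, hbv, hba, rfl⟩ :=
    exists_eq_insert_pair (card_facet_eq_three hT ht) hav.symm hv hat
  have habs := abs_cross_eq_one_of_facet hT ht
  obtain ⟨ma, hma⟩ := mem_lattice_of_mem_face hT ht.1 (v := a) (by simp)
  obtain ⟨mb, hmb⟩ := mem_lattice_of_mem_face hT ht.1 (v := b) (by simp)
  obtain ⟨mx, hmx⟩ := hx
  have hsum : ∀ {M : Type} [AddCommMonoid M] (f : (Fin 2 → ℝ) → M),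
      ∑ u ∈ {v, a, b}, f u = f v + (f a + f b) := fun f => by
    rw [Finset.sum_insert (by simp [hav.symm, hbv.symm]), Finset.sum_pair hba.symm]
  rw [hsum] at hw1 hmx
  have h0 := congrFun hmx 0
  have h1 := congrFun hmx 1
  have ha0 := congrFun hma 0
  have ha1 := congrFun hma 1
  have hb0 := congrFun hmb 0
  have hb1 := congrFun hmb 1
  simp only [Pi.add_apply, Pi.smul_apply, smul_eq_mul] at h0 h1 ha0 ha1 hb0 hb1
  -- Cramer's rule with base point `a`; the determinant on the left is `±1`, that on the right an
  -- integer.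
  have key : w v * cross (a - v) (b - v) =
      (((mb 0 - ma 0) * (mx 1 - n * ma 1) - (mb 1 - ma 1) * (mx 0 - n * ma 0) : ℤ) : ℝ) := by
    push_cast
    rw [h0, h1, ha0, ha1, hb0, hb1, ← hw1]
    simp only [cross, Pi.sub_apply]
    ring
  obtain ⟨z, hz⟩ : ∃ z : ℤ, w v = z := by
    rcases eq_or_eq_neg_of_abs_eq habs with h | h
    · rw [h, mul_one] at key
      exact ⟨_, key⟩
    · rw [h, mul_neg_one, neg_eq_iff_eq_neg] at key
      exact ⟨_, key.trans (Int.cast_neg _).symm⟩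
  have hz0 : 0 ≤ z := by
    have := hw v hv
    rw [hz] at this
    exact_mod_cast this
  exact ⟨z.toNat, by rw [hz]; exact_mod_cast (Int.toNat_of_nonneg hz0).symm⟩

/-- The integral weights come from a triangle containing the rescaled point. Discarding the zero
weights leaves the face carrying it in its relative interior. -/
theorem exists_weights_of_mem_lattice {T : Geometry.SimplicialComplex ℝ (Fin 2 → ℝ)}
    {P : Set (Fin 2 → ℝ)} (hP : IsLatticePolygon P) (hT : IsUnimodularTriangulation T P)
    {n : ℕ} (hn : 1 ≤ n) {x : Fin 2 → ℝ} (hx : x ∈ latticePoints ((n : ℝ) • P)) :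
    ∃ s ∈ T.faces, ∃ k ∈ compositions s n, weightedSum k = x := by
  obtain ⟨⟨p, hpP, rfl⟩, hxl⟩ := hx
  obtain ⟨t, ht, hpt⟩ := exists_mem_facet hP hT hpP
  obtain ⟨w, hw0, hw1, rfl⟩ := Finset.mem_convexHull'.1 hpt
  simp only [Finset.smul_sum, smul_smul] at hxl ⊢
  have hn1 : ∑ v ∈ t, (n : ℝ) * w v = n := by rw [← Finset.mul_sum, hw1, mul_one]
  choose! m hm using fun v (hv : v ∈ t) => exists_nat_weight hT ht
    (w := fun v => (n : ℝ) * w v) (fun v hv => mul_nonneg n.cast_nonneg (hw0 v hv)) hn1 hxl hv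
  set k : (Fin 2 → ℝ) →₀ ℕ := Finsupp.indicator t fun v _ => m v with hk
  have hkv : ∀ v ∈ t, k v = m v := fun v hv => by rw [hk, Finsupp.indicator_of_mem hv]
  have hsupp : k.support ⊆ t := Finsupp.support_indicator_subset _ _
  have htot : ∑ v ∈ k.support, k v = n := by
    rw [Finset.sum_subset hsupp fun v _ hv => Finsupp.notMem_support_iff.1 hv,
      Finset.sum_congr rfl hkv]
    have : ∑ v ∈ t, (m v : ℝ) = n := by rw [← hn1, Finset.sum_congr rfl hm]
    exact_mod_cast this
  have hne : k.support.Nonempty := by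
    rw [Finset.nonempty_iff_ne_empty]
    intro h
    rw [h, Finset.sum_empty] at htot
    omega
  refine ⟨k.support, T.down_closed ht.1 hsupp hne, k, mem_compositions.2 ⟨rfl, htot⟩, ?_⟩
  rw [weightedSum, Finset.sum_subset hsupp fun v _ hv => by
    rw [Finsupp.notMem_support_iff.1 hv]; simp]
  exact Finset.sum_congr rfl fun v hv => by rw [hkv v hv, ← hm v hv]

theorem pos_combination_of_composition {s : Finset (Fin 2 → ℝ)} {n : ℕ} (hn : 1 ≤ n)
    {k : (Fin 2 → ℝ) →₀ ℕ} (hk : k ∈ compositions s n) :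
    (∀ v ∈ s, (0 : ℝ) < k v / n) ∧ ∑ v ∈ s, (k v : ℝ) / n = 1 ∧
      (n : ℝ) • ∑ v ∈ s, ((k v : ℝ) / n) • v = weightedSum k := by
  obtain ⟨rfl, h2⟩ := mem_compositions.1 hk
  have hn0 : (0 : ℝ) < n := by exact_mod_cast hn
  refine ⟨fun v hv => div_pos ?_ hn0, ?_, ?_⟩
  · exact_mod_cast Nat.pos_of_ne_zero (Finsupp.mem_support_iff.1 hv)
  · rw [← Finset.sum_div, div_eq_one_iff_eq hn0.ne']
    exact_mod_cast h2
  · rw [weightedSum, Finset.smul_sum]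
    refine Finset.sum_congr rfl fun v _ => ?_
    rw [smul_smul, mul_div_cancel₀ _ hn0.ne']

theorem weightedSum_mem_latticePoints {T : Geometry.SimplicialComplex ℝ (Fin 2 → ℝ)}
    {P : Set (Fin 2 → ℝ)} (hT : IsUnimodularTriangulation T P)
    {n : ℕ} (hn : 1 ≤ n) {s : Finset (Fin 2 → ℝ)} (hs : s ∈ T.faces)
    {k : (Fin 2 → ℝ) →₀ ℕ} (hk : k ∈ compositions s n) :
    weightedSum k ∈ latticePoints ((n : ℝ) • P) := by
  obtain ⟨h0, h1, h2⟩ := pos_combination_of_composition hn hk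
  constructor
  · rw [← h2]
    refine Set.smul_mem_smul_set ?_
    rw [← hT.space_eq]
    exact T.convexHull_subset_space hs
      (Finset.mem_convexHull'.2 ⟨_, fun v hv => (h0 v hv).le, h1, rfl⟩)
  · have hlat : ∀ v ∈ k.support, ∃ m : Fin 2 → ℤ, (fun i => (m i : ℝ)) = v := fun v hv =>
      mem_lattice_of_mem_face hT hs ((mem_compositions.1 hk).1 ▸ hv)
    choose! m hm using hlat
    refine ⟨fun i => ∑ v ∈ k.support, k v * m v i, funext fun i => ?_⟩
    push_cast
    rw [weightedSum, Finset.sum_apply]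
    refine Finset.sum_congr rfl fun v hv => ?_
    rw [Pi.smul_apply, smul_eq_mul]
    exact congrArg _ (congrFun (hm v hv) i)

theorem weightedSum_injective {T : Geometry.SimplicialComplex ℝ (Fin 2 → ℝ)}
    {n : ℕ} (hn : 1 ≤ n) {s t : Finset (Fin 2 → ℝ)} (hs : s ∈ T.faces) (ht : t ∈ T.faces)
    {k l : (Fin 2 → ℝ) →₀ ℕ} (hk : k ∈ compositions s n) (hl : l ∈ compositions t n)
    (h : weightedSum k = weightedSum l) : k = l := by
  obtain ⟨h0, h1, h2⟩ := pos_combination_of_composition hn hk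
  obtain ⟨h0', h1', h2'⟩ := pos_combination_of_composition hn hl
  have hn0 : (n : ℝ) ≠ 0 := by exact_mod_cast (show n ≠ 0 by omega)
  rw [← h2, ← h2'] at h
  obtain ⟨rfl, hv⟩ := eq_of_pos_combination_eq hs ht h0 h1 h0' h1' (smul_right_injective _ hn0 h)
  ext v
  by_cases hvs : v ∈ s
  · have := hv v hvs
    rw [div_left_inj' hn0] at this
    exact_mod_cast this
  · rw [Finsupp.notMem_support_iff.1 (by rwa [(mem_compositions.1 hk).1]),
      Finsupp.notMem_support_iff.1 (by rwa [(mem_compositions.1 hl).1])]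

theorem discreteMomentVector_eq_sum_faces {T : Geometry.SimplicialComplex ℝ (Fin 2 → ℝ)}
    {P : Set (Fin 2 → ℝ)} (hP : IsLatticePolygon P) (hT : IsUnimodularTriangulation T P)
    {n : ℕ} (hn : 1 ≤ n) {F : Finset (Finset (Fin 2 → ℝ))} (hF : ∀ s, s ∈ F ↔ s ∈ T.faces) :
    discreteMomentVector ((n : ℝ) • P) =
      ∑ s ∈ F, ((n * (n - 1).choose (s.card - 1) : ℝ) / s.card) • ∑ v ∈ s, v := by
  classical
  have himg : latticePoints ((n : ℝ) • P) =
      weightedSum '' (F.biUnion fun s => compositions s n : Finset _) := by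
    ext x
    simp only [Set.mem_image, Finset.mem_coe, Finset.mem_biUnion]
    constructor
    · intro hx
      obtain ⟨s, hs, k, hk, rfl⟩ := exists_weights_of_mem_lattice hP hT hn hx
      exact ⟨k, ⟨s, (hF s).2 hs, hk⟩, rfl⟩
    · rintro ⟨k, ⟨s, hs, hk⟩, rfl⟩
      exact weightedSum_mem_latticePoints hT hn ((hF s).1 hs) hk
  have hinj : Set.InjOn weightedSum (F.biUnion fun s => compositions s n : Finset _) := by
    intro k hk l hl h
    simp only [Finset.mem_coe, Finset.mem_biUnion] at hk hl
    obtain ⟨s, hs, hk⟩ := hk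
    obtain ⟨t, ht, hl⟩ := hl
    exact weightedSum_injective hn ((hF s).1 hs) ((hF t).1 ht) hk hl h
  rw [discreteMomentVector, himg, finsum_mem_image hinj, finsum_mem_coe_finset,
    Finset.sum_biUnion]
  · exact Finset.sum_congr rfl fun s hs => sum_weightedSum_compositions s
      (Geometry.SimplicialComplex.nonempty_of_mem_faces ((hF s).1 hs)) hn
  · intro s _ t _ hst
    refine Finset.disjoint_left.2 fun k hk hl => hst ?_
    rw [← (mem_compositions.1 hk).1, (mem_compositions.1 hl).1]

/-- The case `n = 1`: positive integers with total `1` consist of a single `1`. -/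
theorem latticePoints_eq_vertices {T : Geometry.SimplicialComplex ℝ (Fin 2 → ℝ)}
    {P : Set (Fin 2 → ℝ)} (hP : IsLatticePolygon P) (hT : IsUnimodularTriangulation T P) :
    latticePoints P = T.vertices := by
  refine Set.Subset.antisymm (fun x hx => ?_) fun x hx =>
    ⟨hT.space_eq ▸ T.vertices_subset_space hx, hT.vertices_subset hx⟩
  obtain ⟨s, hs, k, hk, rfl⟩ := exists_weights_of_mem_lattice hP hT le_rfl (n := 1)
    (by simpa using hx)
  obtain ⟨rfl, h1⟩ := mem_compositions.1 hk
  have hpos : ∀ v ∈ k.support, 1 ≤ k v := fun v hv =>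
    Nat.one_le_iff_ne_zero.2 (Finsupp.mem_support_iff.1 hv)
  have hcard : k.support.card = 1 := by
    have h2 := Finset.card_nsmul_le_sum _ _ _ hpos
    have h3 := (Geometry.SimplicialComplex.nonempty_of_mem_faces hs).card_pos
    rw [h1] at h2
    simp only [smul_eq_mul, mul_one] at h2
    omega
  obtain ⟨v, hv⟩ := Finset.card_eq_one.1 hcard
  rw [weightedSum]
  rw [hv, Finset.sum_singleton] at h1 ⊢
  rw [h1, Nat.cast_one, one_smul]
  rwa [hv] at hs

/-! ### Double counting -/

theorem sum_powersetCard_two {t : Finset (Fin 2 → ℝ)} (ht : t.card = 3) :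
    ∑ e ∈ t.powersetCard 2, ∑ v ∈ e, v = (2 : ℝ) • ∑ v ∈ t, v := by
  have hinj : Set.InjOn t.erase t := Finset.erase_injOn t
  have h1 : t.image t.erase = t.powersetCard 2 := by
    refine Finset.eq_of_subset_of_card_le (fun e he => ?_) ?_
    · obtain ⟨x, hx, rfl⟩ := Finset.mem_image.1 he
      exact Finset.mem_powersetCard.2
        ⟨Finset.erase_subset _ _, by rw [Finset.card_erase_of_mem hx, ht]⟩
    · rw [Finset.card_powersetCard, Finset.card_image_of_injOn hinj, ht]
      decide
  rw [← h1, Finset.sum_image hinj, Finset.sum_congr rfl fun x hx =>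
    Finset.sum_erase_eq_sub (f := fun v => v) hx, Finset.sum_sub_distrib, Finset.sum_const, ht]
  module

open scoped Classical in
-- Counts pairs of an edge inside a triangle, by triangles and by edges.
theorem sum_triangles_eq {T : Geometry.SimplicialComplex ℝ (Fin 2 → ℝ)}
    {P : Set (Fin 2 → ℝ)} (hP : IsLatticePolygon P) (hT : IsUnimodularTriangulation T P)
    {F : Finset (Finset (Fin 2 → ℝ))} (hF : ∀ s, s ∈ F ↔ s ∈ T.faces) :
    (2 : ℝ) • ∑ t ∈ F with t.card = 3, ∑ v ∈ t, v =
      (2 : ℝ) • (∑ e ∈ F with e.card = 2 ∧ e ∈ interiorEdges T P, ∑ v ∈ e, v)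
        + ∑ e ∈ F with e.card = 2 ∧ e ∉ interiorEdges T P, ∑ v ∈ e, v := by
  have h1 : ∀ t ∈ F.filter (fun t => t.card = 3), (2 : ℝ) • ∑ v ∈ t, v =
      ∑ e ∈ F with e.card = 2, if e ⊆ t then ∑ v ∈ e, v else 0 := by
    intro t ht
    rw [Finset.mem_filter] at ht
    rw [← sum_powersetCard_two ht.2, ← Finset.sum_filter]
    refine Finset.sum_congr (Finset.ext fun e => ?_) fun _ _ => rfl
    simp only [Finset.mem_powersetCard, Finset.mem_filter]
    refine ⟨fun ⟨h, hc⟩ => ⟨⟨(hF e).2 (T.down_closed ((hF t).1 ht.1) h ?_), hc⟩, h⟩,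
      fun h => ⟨h.2, h.1.2⟩⟩
    exact Finset.card_pos.1 (by omega)
  rw [Finset.smul_sum, Finset.sum_congr rfl h1, Finset.sum_comm]
  have h2 : ∀ e ∈ F.filter (fun e => e.card = 2),
      (∑ t ∈ F with t.card = 3, if e ⊆ t then ∑ v ∈ e, v else 0) =
        (if e ∈ interiorEdges T P then (2 : ℝ) • ∑ v ∈ e, v else ∑ v ∈ e, v) := by
    intro e he
    rw [Finset.mem_filter] at he
    rw [← Finset.sum_filter, Finset.sum_const, card_triangles_containing hP hT ((hF e).1 he.1)
      he.2 (F := F.filter fun t => t.card = 3) (fun t => by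
        rw [Finset.mem_filter, hF, mem_facets_iff_card hP hT])]
    split_ifs <;> module
  rw [Finset.sum_congr rfl h2, Finset.sum_ite, Finset.filter_filter, Finset.filter_filter,
    Finset.smul_sum]

open scoped Classical in
-- Counts pairs of a vertex on a boundary edge, by edges and by vertices.
theorem sum_boundary_edges_eq {T : Geometry.SimplicialComplex ℝ (Fin 2 → ℝ)}
    {P : Set (Fin 2 → ℝ)} (hP : IsLatticePolygon P) (hT : IsUnimodularTriangulation T P)
    {F : Finset (Finset (Fin 2 → ℝ))} (hF : ∀ s, s ∈ F ↔ s ∈ T.faces) :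
    ∑ e ∈ F with e.card = 2 ∧ e ∉ interiorEdges T P, ∑ v ∈ e, v =
      (2 : ℝ) • ∑ᶠ x ∈ latticePoints (frontier P), x := by
  set V := (latticePoints_finite hP.isBounded).toFinset with hV
  have hmem : ∀ v, v ∈ V ↔ v ∈ T.vertices := fun v => by
    rw [hV, Set.Finite.mem_toFinset, latticePoints_eq_vertices hP hT]
  have hfr : latticePoints (frontier P) = (V.filter fun v => v ∈ frontier P : Finset _) := by
    ext v
    rw [Finset.mem_coe, Finset.mem_filter, hV, Set.Finite.mem_toFinset]
    exact ⟨fun h => ⟨⟨hP.isClosed.frontier_subset h.1, h.2⟩, h.1⟩, fun h => ⟨h.2, h.1.2⟩⟩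
  rw [hfr, finsum_mem_coe_finset]
  have h1 : ∀ e ∈ F.filter (fun e => e.card = 2 ∧ e ∉ interiorEdges T P),
      ∑ v ∈ e, v = ∑ v ∈ V, if v ∈ e then v else 0 := by
    intro e he
    rw [← Finset.sum_filter]
    refine Finset.sum_congr (Finset.ext fun v => ?_) fun _ _ => rfl
    rw [Finset.mem_filter, hmem]
    refine ⟨fun h => ⟨?_, h⟩, fun h => h.2⟩
    exact T.down_closed ((hF e).1 (Finset.mem_filter.1 he).1) (Finset.singleton_subset_iff.2 h)
      (Finset.singleton_nonempty v)
  rw [Finset.sum_congr rfl h1, Finset.sum_comm, Finset.sum_filter, Finset.smul_sum]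
  refine Finset.sum_congr rfl fun v hv => ?_
  rw [← Finset.sum_filter, Finset.sum_const, card_boundary_edges_at hP hT ((hmem v).1 hv)
    (fun e => by rw [Finset.mem_filter, hF, and_assoc])]
  split_ifs <;> module

end LatticePolygon

/-! ### Assembling the formula -/

theorem mainTheorem8 (P : Set (Fin 2 → ℝ)) (hP : LatticePolygon.IsLatticePolygon P)
    (T : Geometry.SimplicialComplex ℝ (Fin 2 → ℝ))
    (hT : LatticePolygon.IsUnimodularTriangulation T P) (n : ℕ) :
    LatticePolygon.discreteMomentVector ((n : ℝ) • P) =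
      ((n : ℝ) / 6) •
          ((2 : ℝ) • (∑ᶠ x ∈ LatticePolygon.latticePoints P, x)
            + (4 : ℝ) • (∑ᶠ x ∈ LatticePolygon.latticePoints (interior P), x)
            - ∑ᶠ e ∈ LatticePolygon.interiorEdges T P, ∑ v ∈ e, v)
        + ((n : ℝ) ^ 2 / 2) • (∑ᶠ x ∈ LatticePolygon.latticePoints (frontier P), x)
        + ((n : ℝ) ^ 3 / 6) •
          ((∑ᶠ x ∈ LatticePolygon.latticePoints (frontier P), x)
            + ∑ᶠ e ∈ LatticePolygon.interiorEdges T P, ∑ v ∈ e, v) := by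
  classical
  open LatticePolygon in
  -- For `n = 0` the dilate is the single point `0`. It is treated apart because the face formula
  -- needs `n ≥ 1`.
  rcases Nat.eq_zero_or_pos n with rfl | hn
  · have hne : P.Nonempty := hP.2.mono interior_subset
    rw [Nat.cast_zero, Set.zero_smul_set hne, discreteMomentVector]
    have h0 : ∀ x ∈ latticePoints (0 : Set (Fin 2 → ℝ)), x = 0 := fun x hx => hx.1
    rw [finsum_mem_congr rfl h0, finsum_mem_zero]
    simp
  · set F := (faces_finite hP hT).toFinset with hFdef
    have hF : ∀ s, s ∈ F ↔ s ∈ T.faces := fun s => by rw [hFdef, Set.Finite.mem_toFinset]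
    have hsplit : (∑ᶠ x ∈ latticePoints P, x) = (∑ᶠ x ∈ latticePoints (interior P), x)
        + ∑ᶠ x ∈ latticePoints (frontier P), x := by
      rw [← finsum_mem_union]
      · congr! 4
        rw [latticePoints, latticePoints, latticePoints, ← Set.union_inter_distrib_right,
          hP.isClosed.frontier_eq, Set.union_sdiff_cancel interior_subset]
      · exact Set.disjoint_left.2 fun x h1 h2 => (hP.isClosed.frontier_eq ▸ h2.1).2 h1.1
      · exact latticePoints_finite (hP.isBounded.subset interior_subset)
      · exact latticePoints_finite (hP.isBounded.subset hP.isClosed.frontier_subset)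
    have hV : ∑ s ∈ F with s.card = 1, ∑ v ∈ s, v = ∑ᶠ x ∈ latticePoints P, x := by
      rw [latticePoints_eq_vertices hP hT]
      have hset : T.vertices =
          ((F.filter fun s => s.card = 1).biUnion id : Finset (Fin 2 → ℝ)) := by
        ext v
        simp only [Finset.coe_biUnion, Set.mem_iUnion, Finset.mem_coe, Finset.mem_filter, id]
        constructor
        · intro hv
          exact ⟨{v}, ⟨(hF _).2 hv, by simp⟩, by simp⟩
        · rintro ⟨s, ⟨hs, hc⟩, hv⟩
          exact T.down_closed ((hF s).1 hs) (Finset.singleton_subset_iff.2 hv) (by simp)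
      rw [hset, finsum_mem_coe_finset, Finset.sum_biUnion]
      · rfl
      · intro s hs t ht hst
        obtain ⟨u, rfl⟩ := Finset.card_eq_one.1 (Finset.mem_filter.1 hs).2
        obtain ⟨v, rfl⟩ := Finset.card_eq_one.1 (Finset.mem_filter.1 ht).2
        simpa [Function.onFun] using fun h : u = v => hst (by rw [h])
    have hE : ∑ e ∈ F with e.card = 2 ∧ e ∈ interiorEdges T P, ∑ v ∈ e, v =
        ∑ᶠ e ∈ interiorEdges T P, ∑ v ∈ e, v := by
      have hset : interiorEdges T P =
          (F.filter fun e => e.card = 2 ∧ e ∈ interiorEdges T P : Finset _) := by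
        ext e
        rw [Finset.mem_coe, Finset.mem_filter, hF]
        refine ⟨fun h => ⟨h.1, ?_, h⟩, fun h => h.2.2⟩
        obtain ⟨-, y, z, hyz, he, -⟩ := h
        rw [show e = {y, z} by exact_mod_cast he, Finset.card_pair hyz]
      conv_rhs => rw [hset]
      rw [finsum_mem_coe_finset]
    have h3 := sum_triangles_eq hP hT hF
    rw [sum_boundary_edges_eq hP hT hF, hE] at h3
    have h2 := Finset.sum_filter_add_sum_filter_not (F.filter fun e => e.card = 2)
      (fun e => e ∈ interiorEdges T P) (fun e => ∑ v ∈ e, v)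
    rw [Finset.filter_filter, Finset.filter_filter, sum_boundary_edges_eq hP hT hF, hE] at h2
    have hmaps : ∀ s ∈ F, s.card ∈ ({1, 2, 3} : Finset ℕ) := by
      intro s hs
      have h1 := (Geometry.SimplicialComplex.nonempty_of_mem_faces ((hF s).1 hs)).card_pos
      have h2 := card_face_le_three hP hT ((hF s).1 hs)
      simp only [Finset.mem_insert, Finset.mem_singleton]
      omega
    have hconst : ∀ c : ℕ, (∑ s ∈ F with s.card = c,
        ((n * (n - 1).choose (s.card - 1) : ℝ) / s.card) • ∑ v ∈ s, v) =
          ((n * (n - 1).choose (c - 1) : ℝ) / c) • ∑ s ∈ F with s.card = c, ∑ v ∈ s, v := by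
      intro c
      rw [Finset.smul_sum]
      exact Finset.sum_congr rfl fun s hs => by rw [(Finset.mem_filter.1 hs).2]
    -- Grouping faces by cardinality gives coefficients `n`, `n(n-1)/2` and `n(n-1)(n-2)/6` for
    -- vertices, edges and triangles.
    rw [discreteMomentVector_eq_sum_faces hP hT hn hF, ← Finset.sum_fiberwise_of_maps_to hmaps,
      Finset.sum_insert (by simp), Finset.sum_pair (by simp), hconst, hconst, hconst, hV, ← h2]
    have h4 : ∑ t ∈ F with t.card = 3, ∑ v ∈ t, v =
        (∑ᶠ e ∈ interiorEdges T P, ∑ v ∈ e, v) + ∑ᶠ x ∈ latticePoints (frontier P), x := by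
      rw [← smul_add] at h3
      exact smul_right_injective _ (two_ne_zero' ℝ) h3
    rw [h4, hsplit]
    -- Removes the truncated subtraction, so that the binomials become polynomials in `m`.
    obtain ⟨m, rfl⟩ : ∃ m, n = m + 1 := ⟨n - 1, by omega⟩
    simp only [Nat.add_sub_cancel, Nat.sub_self, Nat.choose_zero_right, Nat.choose_one_right,
      show 2 - 1 = 1 from rfl, show 3 - 1 = 2 from rfl, Nat.cast_choose_two]
    push_cast
    module
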